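/- **Setting.** Let $N,K\ge 0$ be integers, $\mathcal X$ a measurable space with a non-zero base measure $\mathrm dx$, and $U^0,\dots,U^N:\mathcal X\to\mathbb R$ potentials with $Z_n:=\int_{\mathcal X}e^{-U^n(x)}\,\mathrm dx<\infty$. Put $\pi^n(\mathrm dx):=Z_n^{-1}e^{-U^n(x)}\,\mathrm dx$, $\boldsymbol\pi:=\pi^0\otimes\cdots\otimes\pi^N$, $\Delta F_n:=\log Z_{n-1}-\log Z_n$ and $\Delta F:=\log Z_0-\log Z_N$. For $n=0,\dots,N$ let $K^n$ be a $\pi^n$-invariant Markov kernel on $\mathcal X$, with $K^0(x,\cdot)=\pi^0$ for all $x$. For $n=1,\dots,N$ and $k=1,\dots,K$ let $P^{n-1}_k(x_{k-1},\mathrm dx_k)$ and $Q^n_{k-1}(x_k,\mathrm dx_{k-1})$ be Markov kernels on $\mathcal X$ such that the path measures $$\mathbb P^{n-1}_K(\mathrm dx_{0:K}):=\pi^{n-1}(\mathrm dx_0)\prod_{k=1}^KP^{n-1}_k(x_{k-1},\mathrm dx_k),\qquad \mathbb Q^{n}_K(\mathrm dx_{0:K}):=\pi^{n}(\mathrm dx_K)\prod_{k=1}^KQ^{n}_{k-1}(x_{k},\mathrm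 dx_{k-1})$$ on $\mathcal X^{K+1}$ are mutually absolutely continuous, and let $$W^n_K:=\Delta F_n-\log\frac{\mathrm d\mathbb Q^n_K}{\mathrm d\mathbb P^{n-1}_K},\qquad \alpha^n_K(x_{0:K},x'_{0:K}):=\exp\bigl(\min\{0,\,W^n_K(x'_{0:K})-W^n_K(x_{0:K})\}\bigr).$$ **Algorithm.** Let $\mathbf X_t=(X^0_t,\dots,X^N_t)$, $t\ge 0$, be generated as follows, where the law of $\mathbf X_0$ is absolutely continuous with respect to $\boldsymbol\pi$. In iteration $t\ge1$, given the past, first draw independently $Y^n_t\sim K^n(X^n_{t-1},\cdot)$ for $n=0,\dots,N$. Then, for every $n\in\{1,\dots,N\}$ with $n\equiv t \pmod 2$, draw independently a forward path $\overrightarrow X^{n-1}_{t,0:K}$ with $\overrightarrow X^{n-1}_{t,0}=Y^{n-1}_t$, $\overrightarrow X^{n-1}_{t,k}\sim P^{n-1}_k(\overrightarrow X^{n-1}_{t,k-1},\cdot)$, and a backward path $\overleftarrow X^{n}_{t,0:K}$ with $\overleftarrow X^{n}_{t,K}=Y^{n}_t$, $\overleftarrow X^{n}_{t,k-1}\sim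 Q^{n}_{k-1}(\overleftarrow X^{n}_{t,k},\cdot)$; with probability $\alpha^n_K(\overrightarrow X^{n-1}_{t,0:K},\overleftarrow X^{n}_{t,0:K})$ set $(X^{n-1}_t,X^n_t):=(\overleftarrow X^n_{t,0},\overrightarrow X^{n-1}_{t,K})$, and otherwise $(X^{n-1}_t,X^n_t):=(Y^{n-1}_t,Y^n_t)$. Components that belong to no such pair are $X^n_t:=Y^n_t$. **Estimators.** Let $\hat\pi^n_T[f]:=\frac1T\sum_{t=1}^Tf(X^n_t)$ and $\Delta\hat F_T:=\frac12(\Delta\overrightarrow F_T+\Delta\overleftarrow F_T)$, where $$e^{-\Delta\overrightarrow F_T}:=\prod_{n=1}^N\frac2T\sum_{\substack{1\le t\le T\\ t\equiv n\,(2)}}e^{-W^n_K(\overrightarrow X^{n-1}_{t,0:K})},\qquad e^{\Delta\overleftarrow F_T}:=\prod_{n=1}^N\frac2T\sum_{\substack{1\le t\le T\\ t\equiv n\,(2)}}e^{W^n_K(\overleftarrow X^{n}_{t,0:K})},$$ defined for all $T$ for which none of these sums is empty. **Proposition.** 1. For every $n\in\{0,\dots,N\}$ and every $\pi^n$-integrable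 $f:\mathcal X\to\mathbb R$, almost surely $\hat\pi^n_T[f]\to\pi^n[f]=\int f\,\mathrm d\pi^n$ as $T\to\infty$. 2. Almost surely $\Delta\hat F_T\to\Delta F$ as $T\to\infty$. 3. If $\mathbb P^{n-1}_K=\mathbb Q^n_K$ for all $n=1,\dots,N$, then for every $T$ for which $\Delta\hat F_T$ is defined, $\Delta\hat F_T=\Delta F$ almost surely. -/

import Mathlib

open MeasureTheory ProbabilityTheory Filter Topology

namespace AccelPT

noncomputable section

/-- The product kernel `x ↦ ⨂ i, κ i x` of finitely many Markov kernels. -/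
def prodKernel {ι α β : Type*} [Fintype ι] [MeasurableSpace α] [MeasurableSpace β]
    (κ : ι → Kernel α β) [∀ i, IsMarkovKernel (κ i)] : Kernel α (ι → β) where
  toFun x := Measure.pi fun i => κ i x
  measurable' := by
    refine Measurable.measure_of_isPiSystem_of_isProbabilityMeasure generateFrom_pi.symm
      isPiSystem_pi ?_
    rintro _ ⟨s, hs, rfl⟩
    simp only [Measure.pi_pi]
    exact Finset.measurable_prod _ fun i _ =>
      Kernel.measurable_coe _ (hs i (Set.mem_univ i))

instance {ι α β : Type*} [Fintype ι] [MeasurableSpace α] [MeasurableSpace β]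
    (κ : ι → Kernel α β) [∀ i, IsMarkovKernel (κ i)] : IsMarkovKernel (prodKernel κ) :=
  ⟨fun x => inferInstanceAs (IsProbabilityMeasure (Measure.pi fun i => κ i x))⟩

/-- The law of the path `(x₀, …, x_K)` started at `x₀`, with `x_{k+1} ∼ P k (x_k, ·)`
for `k = 0, …, K - 1`. -/
def pathKernel {𝓧 : Type*} [MeasurableSpace 𝓧] :
    (K : ℕ) → (Fin K → Kernel 𝓧 𝓧) → Kernel 𝓧 (Fin (K + 1) → 𝓧)
  | 0, _ => Kernel.deterministic (fun x _ => x) (by fun_prop)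
  | K + 1, P =>
      (Kernel.id ×ₖ (pathKernel K (fun k => P k.succ) ∘ₖ P 0)).map
        fun p => Fin.cons (α := fun _ => 𝓧) p.1 p.2

theorem measurable_cons {𝓧 : Type*} [MeasurableSpace 𝓧] (K : ℕ) :
    Measurable fun p : 𝓧 × (Fin (K + 1) → 𝓧) => Fin.cons (α := fun _ => 𝓧) p.1 p.2 := by
  refine measurable_pi_lambda _ fun i => ?_
  refine Fin.cases ?_ (fun i => ?_) i
  · simpa using measurable_fst
  · simp only [Fin.cons_succ]
    fun_prop

instance isMarkovKernel_pathKernel {𝓧 : Type*} [MeasurableSpace 𝓧] :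
    (K : ℕ) → (P : Fin K → Kernel 𝓧 𝓧) → [∀ k, IsMarkovKernel (P k)] →
      IsMarkovKernel (pathKernel K P)
  | 0, _, _ => by unfold pathKernel; infer_instance
  | K + 1, P, _ => by
      have := isMarkovKernel_pathKernel K (fun k => P k.succ)
      unfold pathKernel
      exact Kernel.IsMarkovKernel.map _ (measurable_cons K)

/-- The law of the path `(x₀, …, x_K)` run backwards from `x_K`, with
`x_k ∼ Q k (x_{k+1}, ·)` for `k = K - 1, …, 0`. -/
def revPathKernel {𝓧 : Type*} [MeasurableSpace 𝓧] (K : ℕ) (Q : Fin K → Kernel 𝓧 𝓧) :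
    Kernel 𝓧 (Fin (K + 1) → 𝓧) :=
  (pathKernel K fun k => Q k.rev).map fun y i => y i.rev

instance {𝓧 : Type*} [MeasurableSpace 𝓧] (K : ℕ) (Q : Fin K → Kernel 𝓧 𝓧)
    [∀ k, IsMarkovKernel (Q k)] : IsMarkovKernel (revPathKernel K Q) :=
  Kernel.IsMarkovKernel.map _ (by fun_prop)

/-- The data of accelerated parallel tempering with `N + 1` chains and `K` acceleration steps.
The swap between chains `n - 1` and `n` (`n = 1, …, N`) is indexed by `j : Fin N`, `n = j + 1`;
so chain `n - 1` is `j.castSucc` and chain `n` is `j.succ`. -/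
structure Data (N K : ℕ) (𝓧 : Type*) [MeasurableSpace 𝓧] where
  /-- the base measure `dx` -/
  base : Measure 𝓧
  /-- the potentials `Uⁿ` -/
  U : Fin (N + 1) → 𝓧 → ℝ
  /-- the local exploration kernels `Kⁿ` -/
  explore : Fin (N + 1) → Kernel 𝓧 𝓧
  /-- `fwd j k` is the forward accelerator `P^{n-1}_{k+1}(x_k, dx_{k+1})`, `n = j + 1` -/
  fwd : Fin N → Fin K → Kernel 𝓧 𝓧
  /-- `bwd j k` is the backward accelerator `Q^n_k(x_{k+1}, dx_k)`, `n = j + 1` -/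
  bwd : Fin N → Fin K → Kernel 𝓧 𝓧
  explore_markov : ∀ n, IsMarkovKernel (explore n)
  fwd_markov : ∀ j k, IsMarkovKernel (fwd j k)
  bwd_markov : ∀ j k, IsMarkovKernel (bwd j k)

attribute [instance] Data.explore_markov Data.fwd_markov Data.bwd_markov

/-- States of all chains. -/
abbrev State (N : ℕ) (𝓧 : Type*) := Fin (N + 1) → 𝓧

/-- Paths `x_{0:K}`. -/
abbrev Path (K : ℕ) (𝓧 : Type*) := Fin (K + 1) → 𝓧

/-- What is sampled for one swap move: the forward path, the backward path, and the uniform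
variable deciding about acceptance. -/
abbrev Draw (K : ℕ) (𝓧 : Type*) := Path K 𝓧 × Path K 𝓧 × unitInterval

/-- The swap between chains `n - 1` and `n`, `n = j + 1`, is proposed at iteration `t` iff
`n ≡ t mod 2`. -/
def Proposed {N : ℕ} (t : ℕ) (j : Fin N) : Prop := (j : ℕ) + 1 ≡ t [MOD 2]

instance {N : ℕ} (t : ℕ) : DecidablePred (Proposed (N := N) t) := fun j =>
  inferInstanceAs (Decidable ((j : ℕ) + 1 ≡ t [MOD 2]))

namespace Data

variable {N K : ℕ} {𝓧 : Type*} [MeasurableSpace 𝓧] (S : Data N K 𝓧)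

/-- The normalising constant `Z_n = ∫ exp(-Uⁿ(x)) dx`. -/
def Z (n : Fin (N + 1)) : ℝ := ∫ x, Real.exp (-S.U n x) ∂S.base

/-- The annealing distribution `πⁿ(dx) = exp(-Uⁿ(x)) / Z_n dx`. -/
def π (n : Fin (N + 1)) : Measure 𝓧 := S.base.tilted fun x => -S.U n x

/-- The joint distribution `π⁰ ⊗ ⋯ ⊗ π^N`. -/
def jointπ : Measure (State N 𝓧) := Measure.pi S.π

/-- `ΔF_n = log Z_{n-1} - log Z_n`, `n = j + 1`. -/
def ΔFstep (j : Fin N) : ℝ := Real.log (S.Z j.castSucc) - Real.log (S.Z j.succ)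

/-- The free energy difference `ΔF = log Z_0 - log Z_N`. -/
def ΔF : ℝ := Real.log (S.Z 0) - Real.log (S.Z (Fin.last N))

/-- The forward path measure `ℙ^{n-1}_K`, `n = j + 1`. -/
def fwdLaw (j : Fin N) : Measure (Path K 𝓧) := (S.π j.castSucc).bind (pathKernel K (S.fwd j))

/-- The backward path measure `ℚ^n_K`, `n = j + 1`. -/
def bwdLaw (j : Fin N) : Measure (Path K 𝓧) := (S.π j.succ).bind (revPathKernel K (S.bwd j))

/-- The standing assumptions. -/
structure Valid : Prop where
  base_ne_zero : S.base ≠ 0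
  integrable_exp : ∀ n, Integrable (fun x => Real.exp (-S.U n x)) S.base
  explore_invariant : ∀ n, Kernel.Invariant (S.explore n) (S.π n)
  /-- the exploration move of the reference chain is an independent draw from the reference -/
  explore_zero : S.explore 0 = Kernel.const 𝓧 (S.π 0)
  fwd_ac_bwd : ∀ j, S.fwdLaw j ≪ S.bwdLaw j
  bwd_ac_fwd : ∀ j, S.bwdLaw j ≪ S.fwdLaw j

/-- The work `W^n_K = ΔF_n - log (dℚ^n_K / dℙ^{n-1}_K)`, `n = j + 1`. -/
def work (j : Fin N) (x : Path K 𝓧) : ℝ :=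
  S.ΔFstep j - Real.log (((S.bwdLaw j).rnDeriv (S.fwdLaw j) x).toReal)

/-- The acceptance probability `α^n_K(x_{0:K}, x'_{0:K})` of the swap, `n = j + 1`. -/
def accept (j : Fin N) (x x' : Path K 𝓧) : ℝ :=
  Real.exp (min 0 (S.work j x' - S.work j x))

/-- The local exploration step, moving all chains independently. -/
def exploreKernel : Kernel (State N 𝓧) (State N 𝓧) :=
  prodKernel fun n => (S.explore n).comap (fun x => x n) (measurable_pi_apply n)

/-- Sampling of what the swap `j` needs, given the state after local exploration: the forward path
from chain `n - 1`, the backward path from chain `n`, and a uniform variable, independently. -/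
def drawKernel (j : Fin N) : Kernel (State N 𝓧) (Draw K 𝓧) :=
  ((pathKernel K (S.fwd j)).comap (fun x => x j.castSucc) (measurable_pi_apply _)) ×ₖ
    (((revPathKernel K (S.bwd j)).comap (fun x => x j.succ) (measurable_pi_apply _)) ×ₖ
      Kernel.const _ (volume : Measure unitInterval))

instance (j : Fin N) : IsMarkovKernel (S.drawKernel j) := by
  unfold drawKernel; infer_instance

/-- All the sampling of iteration `t`, given the state after iteration `t - 1`: local exploration,
followed by independent draws for the swaps proposed at iteration `t`. -/
def iterKernel (t : ℕ) :
    Kernel (State N 𝓧) (State N 𝓧 × ({j : Fin N // Proposed t j} → Draw K 𝓧)) :=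
  S.exploreKernel ⊗ₖ Kernel.prodMkLeft _
    (prodKernel fun j : {j : Fin N // Proposed t j} => S.drawKernel j.1)

/-- The swap is carried out iff the uniform variable is below the acceptance probability. -/
def Accepted (j : Fin N) (d : Draw K 𝓧) : Prop :=
  (d.2.2 : ℝ) < S.accept j d.1 d.2.1

open Classical in
/-- The state after the communication step of iteration `t`, given the state `y` after local
exploration and the draws `d` (which are read only for the swaps proposed at iteration `t`). In an
accepted swap between chains `n - 1` and `n`, chain `n` receives the end point of the forward path
and chain `n - 1` the starting point of the backward path. -/
def communicate (t : ℕ) (y : State N 𝓧) (d : Fin N → Draw K 𝓧) : State N 𝓧 := fun i =>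
  if h : 0 < (i : ℕ) ∧ (i : ℕ) ≡ t [MOD 2] then
    let j : Fin N := ⟨i - 1, by omega⟩
    if S.Accepted j (d j) then (d j).1 (Fin.last K) else y i
  else if h : (i : ℕ) < N ∧ (i : ℕ) + 1 ≡ t [MOD 2] then
    let j : Fin N := ⟨i, h.1⟩
    if S.Accepted j (d j) then (d j).2.1 0 else y i
  else y i

/-- `X 0, X 1, …` is generated by accelerated parallel tempering, on a probability space with a
filtration `ℱ`: in iteration `t + 1`, conditionally on `ℱ t`, the state `Y (t + 1)` after local
exploration and the draws `D (t + 1) j` for the proposed swaps are sampled from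
`S.iterKernel (t + 1) (X t)`, and the communication step then yields `X (t + 1)`.
The law of the initial state is absolutely continuous with respect to `π⁰ ⊗ ⋯ ⊗ π^N`. -/
structure IsRun {Ω : Type*} {mΩ : MeasurableSpace Ω} (μ : Measure Ω) (ℱ : Filtration ℕ mΩ)
    (X Y : ℕ → Ω → State N 𝓧) (D : ℕ → Fin N → Ω → Draw K 𝓧) : Prop where
  measurable_X : ∀ t, Measurable[ℱ t] (X t)
  measurable_Y : ∀ t, Measurable[ℱ (t + 1)] (Y (t + 1))
  measurable_D : ∀ t j, Proposed (t + 1) j → Measurable[ℱ (t + 1)] (D (t + 1) j)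
  init : μ.map (X 0) ≪ S.jointπ
  sample : ∀ t (A : Set Ω), MeasurableSet[ℱ t] A →
    ∀ B : Set (State N 𝓧 × ({j : Fin N // Proposed (t + 1) j} → Draw K 𝓧)), MeasurableSet B →
      μ (A ∩ (fun ω => (Y (t + 1) ω, fun j => D (t + 1) j.1 ω)) ⁻¹' B) =
        ∫⁻ ω in A, S.iterKernel (t + 1) (X t ω) B ∂μ
  update : ∀ t, ∀ᵐ ω ∂μ, X (t + 1) ω = S.communicate (t + 1) (Y (t + 1) ω) fun j => D (t + 1) j ω

variable {Ω : Type*}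

/-- The estimator `exp(-ΔF_T) = ∏ n, (2 / T) ∑_{t ≤ T, t ≡ n mod 2} exp(-W^n_K)` of `ΔF` from the
forward paths. -/
def fwdFreeEnergy (D : ℕ → Fin N → Ω → Draw K 𝓧) (T : ℕ) (ω : Ω) : ℝ :=
  -Real.log (∏ j : Fin N, (2 / (T : ℝ)) *
    ∑ t ∈ Finset.Icc 1 T with Proposed t j, Real.exp (-S.work j (D t j ω).1))

/-- The estimator `exp(ΔF_T) = ∏ n, (2 / T) ∑_{t ≤ T, t ≡ n mod 2} exp(W^n_K)` of `ΔF` from the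
backward paths. -/
def bwdFreeEnergy (D : ℕ → Fin N → Ω → Draw K 𝓧) (T : ℕ) (ω : Ω) : ℝ :=
  Real.log (∏ j : Fin N, (2 / (T : ℝ)) *
    ∑ t ∈ Finset.Icc 1 T with Proposed t j, Real.exp (S.work j (D t j ω).2.1))

/-- The free energy estimator, the mean of the forward and the backward one. -/
def freeEnergy (D : ℕ → Fin N → Ω → Draw K 𝓧) (T : ℕ) (ω : Ω) : ℝ :=
  (S.fwdFreeEnergy D T ω + S.bwdFreeEnergy D T ω) / 2

end Data

/-- The Monte Carlo average of `f` over the first `T` states of the `n`-th chain. -/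
def chainAverage {N : ℕ} {𝓧 Ω : Type*} (X : ℕ → Ω → State N 𝓧) (n : Fin (N + 1)) (f : 𝓧 → ℝ)
    (T : ℕ) (ω : Ω) : ℝ :=
  (1 / (T : ℝ)) * ∑ t ∈ Finset.Icc 1 T, f (X t ω n)

end

end AccelPT

/-! The sampling of one iteration (its parity, the state after exploration, the draws for the swaps)
is collected in a record. Although the algorithm alternates between two kinds of iterations, the
records form a time-homogeneous Markov chain with kernel `recordKernel`. The state averages and the
free energy averages are all averages of functions of the record, so both convergence claims follow
from one law of large numbers for this chain, valid for every initial law that is absolutely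
continuous with respect to the stationary one.

That law of large numbers (`IsChain.tendsto_average`) is Birkhoff's theorem for the shift on
trajectories. By `ergodic_shift`, the stationary shift is ergodic as soon as bounded harmonic
functions are almost everywhere constant. Two facts about the algorithm are then needed.

Stationarity (`Valid.prod_bind_pairKernel`): a swap is a Metropolis move on pairs of paths. With `ρ
= dℚ/dℙ`, the acceptance probability times `ρ x'` is `min (ρ x) (ρ x')`, which is symmetric, so
exchanging the two paths leaves the accepted mass unchanged.

Constancy of harmonic functions (`Valid.jointπ_ac_iterate`, `Valid.ae_const_of_harmonic`): from
every starting state, the law after `2 * (N + 1)` iterations dominates `jointπ`. The exploration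
kernels other than `K⁰` need not mix at all. What mixes is that chain `0` is redrawn from `π⁰` in
each iteration and that acceptance probabilities are positive. If all swaps are accepted, fresh
draws travel up to chain `N` and down again, and mutual absolute continuity of the path measures
turns domination of `π` at one chain into domination at the neighbouring one.

For the free energy, `exp (-W)` has mean `exp (-ΔF_n)` under `ℙ` and `exp W` has mean `exp ΔF_n`
under `ℚ`. Each swap is proposed in every second iteration, whence the factor `2 / T`, and the
`ΔF_n` telescope. If `ℙ = ℚ`, then `W = ΔF_n` almost surely, and the only error left, the number of
proposals differing from `T / 2`, enters the two estimators with opposite signs. -/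

namespace AccelPT

/-! ### The pointwise ergodic theorem. -/

section Birkhoff

variable {α : Type*} {T : α → α} {f : α → ℝ}

/-- The maximum of the Birkhoff sums `S₁, …, S_{n+1}` of `f`. -/
noncomputable def birkhoffMax (T : α → α) (f : α → ℝ) : ℕ → α → ℝ
  | 0, x => f x
  | n + 1, x => f x + max 0 (birkhoffMax T f n (T x))

theorem birkhoffMax_le_succ (n : ℕ) (x : α) : birkhoffMax T f n x ≤ birkhoffMax T f (n + 1) x := by
  induction n generalizing x with
  | zero => simp [birkhoffMax]
  | succ n ih =>
    rw [birkhoffMax, birkhoffMax]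
    gcongr
    exact ih _

theorem birkhoffMax_monotone (x : α) : Monotone fun n => birkhoffMax T f n x :=
  monotone_nat_of_le_succ fun n => birkhoffMax_le_succ n x

theorem birkhoffSum_le_birkhoffMax (n : ℕ) (x : α) :
    birkhoffSum T f (n + 1) x ≤ birkhoffMax T f n x := by
  induction n generalizing x with
  | zero => simp [birkhoffMax]
  | succ n ih =>
    rw [birkhoffMax, birkhoffSum_succ']
    gcongr
    exact (ih _).trans (le_max_right _ _)

theorem birkhoffSum_sub_const (c : ℝ) (n : ℕ) (x : α) :
    birkhoffSum T (fun y => f y - c) n x = birkhoffSum T f n x - n * c := by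
  simp [birkhoffSum, Finset.sum_sub_distrib]

variable [MeasurableSpace α] {μ : Measure α}

theorem measurable_birkhoffMax (hT : Measurable T) (hf : Measurable f) (n : ℕ) :
    Measurable (birkhoffMax T f n) := by
  induction n with
  | zero => exact hf
  | succ n ih => exact hf.add (measurable_const.max (ih.comp hT))

theorem integrable_birkhoffMax (hT : MeasurePreserving T μ μ) (hf : Integrable f μ) (n : ℕ) :
    Integrable (birkhoffMax T f n) μ := by
  induction n with
  | zero => exact hf
  | succ n ih =>
    exact hf.add ((integrable_zero α ℝ μ).sup (hT.integrable_comp_of_integrable ih))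

/-- The set where the maxima `M_n` are unbounded is invariant, hence null or conull. If it were
conull, then `M_{n+1} - M_n ∘ T = f + max (-M_n ∘ T) 0` would decrease to `f`; its integrals are
nonnegative because `T` preserves `μ` and `M_n` increases, so `∫ f` would be nonnegative. -/
theorem ae_birkhoffSum_bddAbove_of_integral_neg [IsProbabilityMeasure μ] (hT : Ergodic T μ)
    (hfm : Measurable f) (hf : Integrable f μ) (hneg : ∫ x, f x ∂μ < 0) :
    ∀ᵐ x ∂μ, ∃ C : ℝ, ∀ n, birkhoffSum T f n x ≤ C := by
  have hTm := hT.toMeasurePreserving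
  set A : Set α := {x | ∀ C : ℕ, ∃ n, (C : ℝ) < birkhoffMax T f n x} with hA
  have hAm : MeasurableSet A := by
    rw [hA, Set.ofPred_forall]
    refine MeasurableSet.iInter fun C => ?_
    rw [Set.ofPred_exists]
    exact MeasurableSet.iUnion fun n =>
      measurableSet_lt measurable_const (measurable_birkhoffMax hTm.measurable hfm n)
  have hinv : T ⁻¹' A = A := by
    ext x
    simp only [Set.mem_preimage, hA, Set.mem_ofPred_eq]
    constructor
    · intro h C
      obtain ⟨C', hC'⟩ := exists_nat_gt ((C : ℝ) - f x)
      obtain ⟨n, hn⟩ := h C'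
      refine ⟨n + 1, ?_⟩
      rw [birkhoffMax]
      have := le_max_right 0 (birkhoffMax T f n (T x))
      linarith
    · intro h C
      obtain ⟨C', hC'⟩ := exists_nat_gt ((C : ℝ) + f x)
      obtain ⟨n, hn⟩ := h C'
      refine ⟨n, ?_⟩
      have h1 := birkhoffMax_le_succ (T := T) (f := f) n x
      rw [birkhoffMax] at h1
      have h2 : (C : ℝ) < max 0 (birkhoffMax T f n (T x)) := by linarith
      rcases lt_max_iff.1 h2 with h3 | h3
      · exact absurd h3 (not_lt.2 (Nat.cast_nonneg C))
      · exact h3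
  have hbdd : ∀ x, x ∉ A → ∃ C : ℝ, ∀ n, birkhoffSum T f n x ≤ C := by
    intro x hx
    simp only [hA, Set.mem_ofPred_eq, not_forall, not_exists, not_lt] at hx
    obtain ⟨C, hC⟩ := hx
    refine ⟨C, fun n => ?_⟩
    cases n with
    | zero => simp
    | succ n => exact (birkhoffSum_le_birkhoffMax n x).trans (hC n)
  rcases hT.toPreErgodic.ae_mem_or_ae_notMem hAm hinv with h | h
  · exfalso
    refine hneg.not_ge ?_
    have hint := integrable_birkhoffMax hTm hf
    have hdiff : ∀ n x, birkhoffMax T f (n + 1) x - birkhoffMax T f n (T x) =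
        f x + max (-birkhoffMax T f n (T x)) 0 := by
      intro n x
      rw [birkhoffMax, add_sub_assoc, ← max_sub_sub_right, zero_sub, sub_self]
    have hnonneg : ∀ n, 0 ≤ ∫ x, (birkhoffMax T f (n + 1) x - birkhoffMax T f n (T x)) ∂μ := by
      intro n
      have hcomp : Integrable (fun x => birkhoffMax T f n (T x)) μ :=
        hTm.integrable_comp_of_integrable (hint n)
      rw [integral_sub (hint _) hcomp]
      have h1 : ∫ x, birkhoffMax T f n (T x) ∂μ = ∫ x, birkhoffMax T f n x ∂μ := by
        conv_rhs => rw [← hTm.map_eq]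
        exact (integral_map hTm.measurable.aemeasurable
          (measurable_birkhoffMax hTm.measurable hfm n).aestronglyMeasurable).symm
      rw [h1, sub_nonneg]
      exact integral_mono (hint _) (hint _) fun x => birkhoffMax_le_succ n x
    have hlim : Tendsto
        (fun n => ∫ x, (birkhoffMax T f (n + 1) x - birkhoffMax T f n (T x)) ∂μ) atTop
        (𝓝 (∫ x, f x ∂μ)) := by
      -- The dominating function works because `M_n (T x)` is at least its first term `f (T x)`.
      refine tendsto_integral_of_dominated_convergence (fun x => |f x| + |f (T x)|)
        (fun n => ((hint _).sub (hTm.integrable_comp_of_integrable (hint n))).aestronglyMeasurable)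
        (hf.abs.add (hTm.integrable_comp_of_integrable hf).abs) (fun n => ?_) ?_
      · refine Eventually.of_forall fun x => ?_
        rw [hdiff, Real.norm_eq_abs]
        refine (abs_add_le _ _).trans ?_
        refine add_le_add_right ?_ _
        rw [abs_of_nonneg (le_max_right (-birkhoffMax T f n (T x)) 0)]
        refine max_le ?_ (abs_nonneg _)
        have h1 : f (T x) ≤ birkhoffMax T f n (T x) := birkhoffMax_monotone (T x) (Nat.zero_le n)
        have h2 := neg_abs_le (f (T x))
        linarith
      · filter_upwards [h] with x hx
        -- Unboundedness is needed at `T x`: from some `n₀` on `M_n (T x)` is positive, and the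
        -- correction to `f x` vanishes.
        rw [← hinv] at hx
        obtain ⟨n₀, hn₀⟩ := hx 0
        refine tendsto_const_nhds.congr' ?_
        filter_upwards [eventually_ge_atTop n₀] with n hn
        have h1 : birkhoffMax T f n₀ (T x) ≤ birkhoffMax T f n (T x) :=
          birkhoffMax_monotone (T x) hn
        rw [hdiff, max_eq_right, add_zero]
        rw [Nat.cast_zero] at hn₀
        linarith
    exact ge_of_tendsto' hlim hnonneg
  · filter_upwards [h] with x hx using hbdd x hx

theorem ae_birkhoffSum_le [IsProbabilityMeasure μ] (hT : Ergodic T μ)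
    (hfm : Measurable f) (hf : Integrable f μ) {c : ℝ} (hc : ∫ x, f x ∂μ < c) :
    ∀ᵐ x ∂μ, ∃ C : ℝ, ∀ n, birkhoffSum T f n x ≤ n * c + C := by
  have h := ae_birkhoffSum_bddAbove_of_integral_neg hT (hfm.sub_const c)
    (hf.sub (integrable_const c)) (by
      rw [integral_sub hf (integrable_const c)]
      simpa using hc)
  filter_upwards [h] with x hx
  obtain ⟨C, hC⟩ := hx
  refine ⟨C, fun n => ?_⟩
  have := hC n
  rw [birkhoffSum_sub_const] at this
  linarith

/-- Only the countably many slopes `m + 1 / (k + 1)` are used, so that one null set serves them all;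
the constants `C` disappear on division by `n`. -/
theorem eventually_inv_mul_lt {s : ℕ → ℝ} {m : ℝ}
    (h : ∀ k : ℕ, ∃ C : ℝ, ∀ n : ℕ, s n ≤ n * (m + 1 / (k + 1)) + C) {a : ℝ} (ha : m < a) :
    ∀ᶠ n : ℕ in atTop, (n : ℝ)⁻¹ * s n < a := by
  obtain ⟨k, hk⟩ := exists_nat_one_div_lt (sub_pos.2 ha)
  obtain ⟨C, hC⟩ := h k
  have h1 : Tendsto (fun n : ℕ => (m + 1 / ((k : ℝ) + 1)) + C * (n : ℝ)⁻¹) atTop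
      (𝓝 ((m + 1 / ((k : ℝ) + 1)) + C * 0)) :=
    (tendsto_inv_atTop_nhds_zero_nat.const_mul C).const_add _
  filter_upwards [h1.eventually_lt_const (u := a) (by linarith), eventually_gt_atTop 0]
    with n hn hn0
  refine lt_of_le_of_lt ?_ hn
  have hn0' : (0 : ℝ) < n := Nat.cast_pos.2 hn0
  calc (n : ℝ)⁻¹ * s n ≤ (n : ℝ)⁻¹ * (n * (m + 1 / (k + 1)) + C) := by gcongr; exact hC n
    _ = _ := by field_simp

/-- The pointwise ergodic theorem for an ergodic transformation of a probability space. -/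
theorem tendsto_birkhoffAverage_of_ergodic [IsProbabilityMeasure μ] (hT : Ergodic T μ)
    (hf : Integrable f μ) :
    ∀ᵐ x ∂μ, Tendsto (fun n => birkhoffAverage ℝ T f n x) atTop (𝓝 (∫ y, f y ∂μ)) := by
  wlog hfm : Measurable f generalizing f
  · have hg := hf.aestronglyMeasurable.ae_eq_mk
    have h := this (hf.congr hg) hf.aestronglyMeasurable.stronglyMeasurable_mk.measurable
    have h2 := ae_all_iff.2 fun n =>
      hT.quasiMeasurePreserving.birkhoffAverage_ae_eq_of_ae_eq ℝ hg n
    filter_upwards [h, h2] with x hx hx2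
    rw [integral_congr_ae hg]
    exact hx.congr fun n => (hx2 n).symm
  have h1 : ∀ᵐ x ∂μ, ∀ k : ℕ, ∃ C : ℝ, ∀ n : ℕ,
      birkhoffSum T f n x ≤ n * (∫ y, f y ∂μ + 1 / (k + 1)) + C :=
    ae_all_iff.2 fun k => ae_birkhoffSum_le hT hfm hf (lt_add_of_pos_right _ (by positivity))
  have h2 : ∀ᵐ x ∂μ, ∀ k : ℕ, ∃ C : ℝ, ∀ n : ℕ,
      birkhoffSum T (fun y => -f y) n x ≤ n * (∫ y, -f y ∂μ + 1 / (k + 1)) + C :=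
    ae_all_iff.2 fun k => ae_birkhoffSum_le hT hfm.neg hf.neg
      (lt_add_of_pos_right _ (by positivity))
  filter_upwards [h1, h2] with x hx1 hx2
  refine tendsto_order.2 ⟨fun a ha => ?_, fun a ha => ?_⟩
  · have := eventually_inv_mul_lt hx2 (a := -a) (by rw [integral_neg]; linarith)
    filter_upwards [this] with n hn
    simp only [birkhoffSum, Finset.sum_neg_distrib, mul_neg] at hn
    simp only [birkhoffAverage, birkhoffSum, smul_eq_mul]
    linarith
  · filter_upwards [eventually_inv_mul_lt hx1 ha] with n hn
    simpa [birkhoffAverage] using hn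

end Birkhoff

end AccelPT

/-! ### The law of large numbers for Markov chains. -/

namespace AccelPT

open scoped ENNReal

section MarkovChain

variable {E : Type*}

/-- Trajectories whose first `n` values lie in `B 0, …, B (n - 1)`. -/
def pathBox (n : ℕ) (B : ℕ → Set E) : Set (ℕ → E) := {x | ∀ i < n, x i ∈ B i}

theorem pathBox_succ (n : ℕ) (B : ℕ → Set E) :
    pathBox (n + 1) B = {x | x 0 ∈ B 0} ∩ (fun x i => x (i + 1)) ⁻¹' pathBox n fun i => B (i + 1) := by
  ext x
  simp only [pathBox, Set.mem_inter_iff, Set.mem_preimage, Set.mem_ofPred_eq]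
  constructor
  · exact fun h => ⟨h 0 (by omega), fun i hi => h (i + 1) (by omega)⟩
  · rintro ⟨h0, h⟩ i hi
    cases i with
    | zero => exact h0
    | succ i => exact h i (by omega)

variable [MeasurableSpace E]

/-- `V` is adapted to `ℱ` and is a Markov chain with transition kernel `κ` with respect to it. -/
structure IsChain {Ω : Type*} {mΩ : MeasurableSpace Ω} (κ : Kernel E E) (μ : Measure Ω)
    (ℱ : Filtration ℕ mΩ) (V : ℕ → Ω → E) : Prop where
  adapted : ∀ t, Measurable[ℱ t] (V t)
  markov : ∀ t (A : Set Ω), MeasurableSet[ℱ t] A → ∀ B : Set E, MeasurableSet B →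
    μ (A ∩ V (t + 1) ⁻¹' B) = ∫⁻ ω in A, κ (V t ω) B ∂μ

/-- The probability that the chain started at `x` passes through `B 0, …, B (n - 1)`. -/
noncomputable def boxProb (κ : Kernel E E) : ℕ → (ℕ → Set E) → E → ℝ≥0∞
  | 0, _, _ => 1
  | n + 1, B, x => (B 0).indicator (fun x => ∫⁻ y, boxProb κ n (fun i => B (i + 1)) y ∂κ x) x

theorem measurable_boxProb (κ : Kernel E E) (n : ℕ) {B : ℕ → Set E}
    (hB : ∀ i, MeasurableSet (B i)) : Measurable (boxProb κ n B) := by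
  induction n generalizing B with
  | zero => exact measurable_const
  | succ n ih =>
    exact ((ih fun i => hB (i + 1)).lintegral_kernel).indicator (hB 0)

theorem measurableSet_pathBox (n : ℕ) {B : ℕ → Set E} (hB : ∀ i, MeasurableSet (B i)) :
    MeasurableSet (pathBox n B) := by
  have : pathBox n B = ⋂ i, ⋂ (_ : i < n), (fun x : ℕ → E => x i) ⁻¹' B i := by
    ext x; simp [pathBox]
  rw [this]
  exact MeasurableSet.iInter fun i => MeasurableSet.iInter fun _ => measurable_pi_apply i (hB i)

/-- Measures on trajectories are determined by their values on boxes. -/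
theorem ext_of_pathBox {M M' : Measure (ℕ → E)} [IsFiniteMeasure M]
    (h : ∀ n (B : ℕ → Set E), (∀ i, MeasurableSet (B i)) → M (pathBox n B) = M' (pathBox n B)) :
    M = M' := by
  refine ext_of_generate_finite
    {s | ∃ n, ∃ B : ℕ → Set E, (∀ i, MeasurableSet (B i)) ∧ pathBox n B = s} ?_ ?_ ?_ ?_
  · apply le_antisymm
    · refine iSup_le fun i => ?_
      rintro _ ⟨s, hs, rfl⟩
      classical
      refine MeasurableSpace.measurableSet_generateFrom
        ⟨i + 1, fun k => if k = i then s else Set.univ, fun k => ?_, ?_⟩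
      · dsimp only; split_ifs
        exacts [hs, MeasurableSet.univ]
      · ext x
        simp only [pathBox, Set.mem_ofPred_eq, Set.mem_preimage]
        constructor
        · intro hx
          simpa using hx i (by omega)
        · intro hx k hk
          split_ifs with hki
          · exact hki ▸ hx
          · trivial
    · refine MeasurableSpace.generateFrom_le ?_
      rintro _ ⟨n, B, hB, rfl⟩
      exact measurableSet_pathBox n hB
  · rintro _ ⟨n, B, hB, rfl⟩ _ ⟨n', B', hB', rfl⟩ -
    classical
    refine ⟨max n n', fun i => (if i < n then B i else Set.univ) ∩
      (if i < n' then B' i else Set.univ), fun i => ?_, ?_⟩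
    · refine MeasurableSet.inter ?_ ?_ <;> split_ifs <;> simp [hB, hB']
    · ext x
      simp only [pathBox, Set.mem_ofPred_eq, Set.mem_inter_iff]
      constructor
      · intro hx
        exact ⟨fun i hi => by simpa [hi] using (hx i (lt_max_of_lt_left hi)).1,
          fun i hi => by simpa [hi] using (hx i (lt_max_of_lt_right hi)).2⟩
      · rintro ⟨h1, h2⟩ i -
        constructor <;> split_ifs with hi
        exacts [h1 i hi, trivial, h2 i hi, trivial]
  · rintro _ ⟨n, B, hB, rfl⟩
    exact h n B hB
  · simpa [pathBox] using h 0 (fun _ => Set.univ) fun _ => MeasurableSet.univ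

namespace IsChain

variable {Ω : Type*} {mΩ : MeasurableSpace Ω} {κ : Kernel E E} {μ : Measure Ω}
  {ℱ : Filtration ℕ mΩ} {V : ℕ → Ω → E}

theorem measurable (h : IsChain κ μ ℱ V) (t : ℕ) : Measurable (V t) :=
  (h.adapted t).mono (ℱ.le t) le_rfl

theorem setLIntegral_succ (h : IsChain κ μ ℱ V) {t : ℕ} {A : Set Ω} (hA : MeasurableSet[ℱ t] A)
    {g : E → ℝ≥0∞} (hg : Measurable g) :
    ∫⁻ ω in A, g (V (t + 1) ω) ∂μ = ∫⁻ ω in A, ∫⁻ y, g y ∂κ (V t ω) ∂μ := by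
  have key : (μ.restrict A).map (V (t + 1)) = ((μ.restrict A).map (V t)).bind κ := by
    ext B hB
    rw [Measure.map_apply (h.measurable _) hB, Measure.bind_apply hB κ.aemeasurable,
      lintegral_map (Kernel.measurable_coe κ hB) (h.measurable t), Measure.restrict_apply
      (h.measurable _ hB), Set.inter_comm, h.markov t A hA B hB]
  rw [← lintegral_map hg (h.measurable _), key, Measure.lintegral_bind κ.aemeasurable
    hg.aemeasurable, lintegral_map hg.lintegral_kernel (h.measurable t)]

theorem map_succ (h : IsChain κ μ ℱ V) (t : ℕ) : μ.map (V (t + 1)) = (μ.map (V t)).bind κ := by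
  refine Measure.ext_of_lintegral _ fun g hg => ?_
  have := h.setLIntegral_succ (t := t) MeasurableSet.univ hg
  simp only [Measure.restrict_univ] at this
  rw [lintegral_map hg (h.measurable _), this, Measure.lintegral_bind κ.aemeasurable
    hg.aemeasurable, lintegral_map hg.lintegral_kernel (h.measurable t)]

theorem map_ac (h : IsChain κ μ ℱ V) {Γ : Measure E} (hinv : κ.Invariant Γ)
    (hac : μ.map (V 0) ≪ Γ) (t : ℕ) : μ.map (V t) ≪ Γ := by
  induction t with
  | zero => exact hac
  | succ t ih =>
    rw [h.map_succ, ← hinv.def]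
    exact ih.comp_right κ

/-- The event `A` and the time `t` are arbitrary for the sake of the induction: the first constraint
of the box is absorbed into the past event, and the remaining ones are those of a shorter box at
time `t + 1`. -/
theorem measure_inter_pathBox (h : IsChain κ μ ℱ V) (n : ℕ) (t : ℕ) {A : Set Ω}
    (hA : MeasurableSet[ℱ t] A) {B : ℕ → Set E} (hB : ∀ i, MeasurableSet (B i)) :
    μ (A ∩ (fun ω i => V (t + i) ω) ⁻¹' pathBox n B) = ∫⁻ ω in A, boxProb κ n B (V t ω) ∂μ := by
  induction n generalizing t A B with
  | zero => simp [pathBox, boxProb]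
  | succ n ih =>
    have h1 : A ∩ (fun ω i => V (t + i) ω) ⁻¹' pathBox (n + 1) B =
        (A ∩ V t ⁻¹' B 0) ∩
          (fun ω i => V (t + 1 + i) ω) ⁻¹' pathBox n (fun i => B (i + 1)) := by
      rw [pathBox_succ]
      ext ω
      simp [and_assoc, Nat.add_right_comm t 1, add_assoc]
    have hA' : MeasurableSet[ℱ t] (A ∩ V t ⁻¹' B 0) :=
      MeasurableSet.inter hA (h.adapted t (hB 0))
    rw [h1, ih (t + 1) (ℱ.mono (Nat.le_succ t) _ hA') fun i => hB (i + 1),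
      h.setLIntegral_succ hA' (measurable_boxProb κ n fun i => hB (i + 1)),
      Set.inter_comm, ← Measure.restrict_restrict (h.measurable t (hB 0)),
      ← lintegral_indicator (h.measurable t (hB 0))]
    rfl

end IsChain

/-- The law of the Markov chain with transition kernel `κ`, as a function of its starting point. -/
noncomputable def chainKernel (κ : Kernel E E) [IsMarkovKernel κ] : Kernel E (ℕ → E) :=
  (Kernel.traj (X := fun _ => E)
    (fun n => κ.comap (fun x : (Π _ : Finset.Iic n, E) => x ⟨n, by simp⟩) (measurable_pi_apply _))
    0).comap (fun x _ => x) (by fun_prop)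

variable (κ : Kernel E E) [IsMarkovKernel κ]

instance : IsMarkovKernel (chainKernel κ) := by unfold chainKernel; infer_instance

theorem isChain_chainKernel (x : E) :
    IsChain κ (chainKernel κ x) (Filtration.piLE (X := fun _ => E)) (fun t p => p t) where
  adapted t := by
    rw [Filtration.piLE_eq_comap_frestrictLe]
    exact (measurable_pi_apply (X := fun _ : Finset.Iic t => E) ⟨t, by simp⟩).comp
      (comap_measurable _)
  markov t A hA B hB := by
    rw [Filtration.piLE_eq_comap_frestrictLe] at hA
    obtain ⟨A', hA', rfl⟩ := hA
    have hm : Measurable (Preorder.frestrictLe (π := fun _ : ℕ => E) t) :=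
      Preorder.measurable_frestrictLe t
    set η : (n : ℕ) → Kernel (Π _ : Finset.Iic n, E) E := fun n =>
      κ.comap (fun x : (Π _ : Finset.Iic n, E) => x ⟨n, by simp⟩) (measurable_pi_apply _) with hη
    have h := Kernel.partialTraj_compProd_eq_map_traj (X := fun _ => E) (κ := η) (Nat.zero_le t)
      (x₀ := fun _ => x)
    have h' := DFunLike.congr_fun h (A' ×ˢ B)
    rw [Measure.map_apply (by fun_prop) (hA'.prod hB), Measure.compProd_apply_prod hA' hB,
      ← Kernel.traj_map_frestrictLe_apply, setLIntegral_map hA'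
      (Kernel.measurable_coe _ hB) hm] at h'
    exact h'.symm

theorem chainKernel_map_zero (x : E) : (chainKernel κ x).map (fun p => p 0) = Measure.dirac x := by
  have h : ∀ η : (n : ℕ) → Kernel (Π _ : Finset.Iic n, E) E, [∀ n, IsMarkovKernel (η n)] →
      (Kernel.traj (X := fun _ => E) η 0 fun _ => x).map (fun p => p 0) = Measure.dirac x := by
    intro η _
    have h1 := Kernel.traj_map_frestrictLe_apply (X := fun _ => E) (κ := η) 0 0 (fun _ => x)
    have h2 : (fun p : ℕ → E => p 0) = (fun q : (Π _ : Finset.Iic 0, E) => q ⟨0, by simp⟩) ∘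
      Preorder.frestrictLe (π := fun _ : ℕ => E) 0 := rfl
    rw [h2, ← Measure.map_map (measurable_pi_apply (X := fun _ : Finset.Iic 0 => E) _)
      (Preorder.measurable_frestrictLe 0), h1,
      Kernel.partialTraj_self, Kernel.id_apply, 
      Measure.map_dirac' (measurable_pi_apply (X := fun _ : Finset.Iic 0 => E) _)]
  exact h _

/-- The shift on trajectories. -/
def shift (p : ℕ → E) (i : ℕ) : E := p (i + 1)

theorem measurable_shift : Measurable (shift (E := E)) := by
  unfold shift; fun_prop

theorem ae_chainKernel_zero (x : E) {B : Set E} (hB : MeasurableSet B) (hx : x ∈ B) :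
    ∀ᵐ p ∂chainKernel κ x, p 0 ∈ B := by
  have h : ∀ᵐ y ∂(chainKernel κ x).map (fun p => p 0), y ∈ B := by
    rw [chainKernel_map_zero]
    exact (ae_dirac_iff hB).2 hx
  exact ae_of_ae_map (measurable_pi_apply 0).aemeasurable h

theorem lintegral_chainKernel_zero (x : E) {g : E → ℝ≥0∞} (hg : Measurable g) :
    ∫⁻ p, g (p 0) ∂chainKernel κ x = g x := by
  rw [← lintegral_map hg (by fun_prop), chainKernel_map_zero, lintegral_dirac' _ hg]

theorem chainKernel_pathBox (x : E) (n : ℕ) {B : ℕ → Set E} (hB : ∀ i, MeasurableSet (B i)) :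
    chainKernel κ x (pathBox n B) = boxProb κ n B x := by
  have h := (isChain_chainKernel κ x).measure_inter_pathBox n 0 MeasurableSet.univ hB
  simp only [Set.univ_inter, zero_add, Measure.restrict_univ] at h
  rw [lintegral_chainKernel_zero κ x (measurable_boxProb κ n hB)] at h
  exact h

theorem chainKernel_map_shift (x : E) :
    (chainKernel κ x).map shift = (κ x).bind (chainKernel κ) := by
  have : IsProbabilityMeasure ((chainKernel κ x).map shift) :=
    Measure.isProbabilityMeasure_map measurable_shift.aemeasurable
  refine ext_of_pathBox fun n B hB => ?_
  -- A shifted box is a box with one free coordinate in front.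
  set B' : ℕ → Set E := fun i => Nat.casesOn i Set.univ B with hB'
  have hB'm : ∀ i, MeasurableSet (B' i) := by
    rintro (_ | i)
    exacts [MeasurableSet.univ, hB i]
  have h1 : shift ⁻¹' pathBox n B = pathBox (n + 1) B' := by
    rw [pathBox_succ]
    ext p
    simp [hB']
    rfl
  rw [Measure.map_apply measurable_shift (measurableSet_pathBox n hB), h1,
    chainKernel_pathBox κ x _ hB'm, Measure.bind_apply (measurableSet_pathBox n hB)
    (chainKernel κ).aemeasurable]
  simp only [chainKernel_pathBox κ _ _ hB, boxProb]
  exact congrFun (Set.indicator_univ _) x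

/-- The starting point is almost surely `x`, so the first condition is deterministic, and the
shifted trajectory is a chain started from `κ x`. -/
theorem chainKernel_inter_shift (x : E) {B : Set E} (hB : MeasurableSet B) {S : Set (ℕ → E)}
    (hS : MeasurableSet S) :
    chainKernel κ x ({p | p 0 ∈ B} ∩ shift ⁻¹' S) =
      B.indicator (fun x => ∫⁻ y, chainKernel κ y S ∂κ x) x := by
  by_cases hx : x ∈ B
  · rw [Set.indicator_of_mem hx, ← Measure.bind_apply hS (chainKernel κ).aemeasurable,
      ← chainKernel_map_shift, Measure.map_apply measurable_shift hS]
    refine measure_congr ?_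
    filter_upwards [ae_chainKernel_zero κ x hB hx] with p hp
    exact propext ⟨fun h => h.2, fun h => ⟨hp, h⟩⟩
  · rw [Set.indicator_of_notMem hx]
    refine measure_mono_null Set.inter_subset_left ?_
    have h := ae_chainKernel_zero κ x hB.compl hx
    rw [ae_iff] at h
    simpa using h

variable {κ}

/-- This reduces almost sure statements about an abstract chain to the canonical one: the path law
depends on the initial law through `chainKernel` only, so absolute continuity of initial laws passes
to path laws. -/
theorem IsChain.map_eq {Ω : Type*} {mΩ : MeasurableSpace Ω} {μ : Measure Ω}
    [IsProbabilityMeasure μ] {ℱ : Filtration ℕ mΩ} {V : ℕ → Ω → E} (h : IsChain κ μ ℱ V) :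
    μ.map (fun ω i => V i ω) = (μ.map (V 0)).bind (chainKernel κ) := by
  have hV : Measurable fun ω i => V i ω := measurable_pi_lambda _ h.measurable
  have : IsProbabilityMeasure (μ.map fun ω i => V i ω) :=
    Measure.isProbabilityMeasure_map hV.aemeasurable
  refine ext_of_pathBox fun n B hB => ?_
  have h1 := h.measure_inter_pathBox n 0 MeasurableSet.univ hB
  simp only [Set.univ_inter, zero_add, Measure.restrict_univ] at h1
  rw [Measure.map_apply hV (measurableSet_pathBox n hB), h1, Measure.bind_apply
    (measurableSet_pathBox n hB) (chainKernel κ).aemeasurable]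
  simp only [chainKernel_pathBox κ _ _ hB]
  rw [lintegral_map (measurable_boxProb κ n hB) (h.measurable 0)]

variable {Γ : Measure E}

theorem measurePreserving_shift (hinv : κ.Invariant Γ) :
    MeasurePreserving shift (Γ.bind (chainKernel κ)) (Γ.bind (chainKernel κ)) := by
  refine ⟨measurable_shift, ?_⟩
  rw [Measure.map_comp _ _ measurable_shift]
  have : (chainKernel κ).map shift = chainKernel κ ∘ₖ κ := by
    ext1 x
    rw [Kernel.map_apply _ measurable_shift, chainKernel_map_shift, Kernel.comp_apply]
  rw [this, ← Measure.comp_assoc, hinv.def]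

variable [IsProbabilityMeasure Γ]

/-- If all bounded harmonic functions are almost everywhere constant, the stationary chain is
ergodic. -/
theorem ergodic_shift (hinv : κ.Invariant Γ)
    (hharm : ∀ h : E → ℝ≥0∞, Measurable h → (∀ x, h x ≤ 1) → (∀ x, ∫⁻ y, h y ∂κ x = h x) →
      ∃ c, h =ᵐ[Γ] fun _ => c) :
    Ergodic shift (Γ.bind (chainKernel κ)) := by
  refine ⟨measurePreserving_shift hinv, ⟨fun A hA hAinv => ?_⟩⟩
  set M := Γ.bind (chainKernel κ) with hM
  have hApply : ∀ S, MeasurableSet S → M S = ∫⁻ x, chainKernel κ x S ∂Γ := fun S hS =>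
    Measure.bind_apply hS (chainKernel κ).aemeasurable
  -- The probability of a shift-invariant event is a harmonic function of the starting point.
  obtain ⟨c, hc⟩ := hharm (fun x => chainKernel κ x A) (Kernel.measurable_coe _ hA)
    (fun x => prob_le_one) (fun x => by
      have := chainKernel_inter_shift κ x MeasurableSet.univ hA
      simp only [Set.mem_univ, Set.indicator_univ] at this
      rw [← this, hAinv]
      congr 1
      ext; simp)
  have hMA : M A = c := by
    rw [hApply A hA, lintegral_congr_ae hc]
    simp
  -- Conditionally on almost every starting point, `A` is independent of each box. In the induction,
  -- the almost everywhere statement for the shorter box is moved back one step through `κ` by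
  -- invariance of `Γ`.
  have hbox : ∀ n (B : ℕ → Set E), (∀ i, MeasurableSet (B i)) →
      ∀ᵐ x ∂Γ, chainKernel κ x (pathBox n B ∩ A) = c * chainKernel κ x (pathBox n B) := by
    intro n
    induction n with
    | zero =>
      intro B _
      filter_upwards [hc] with x hx
      simpa [pathBox] using hx
    | succ n ih =>
      intro B hB
      have h1 := ih (fun i => B (i + 1)) fun i => hB (i + 1)
      rw [← hinv.def] at h1
      have h2 := Measure.ae_ae_of_ae_bind κ.aemeasurable h1
      filter_upwards [h2] with x hx
      have e : pathBox (n + 1) B ∩ A =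
          {p | p 0 ∈ B 0} ∩ shift ⁻¹' (pathBox n (fun i => B (i + 1)) ∩ A) := by
        rw [pathBox_succ, Set.preimage_inter, hAinv, Set.inter_assoc]
        rfl
      have e' : pathBox (n + 1) B =
          {p | p 0 ∈ B 0} ∩ shift ⁻¹' (pathBox n (fun i => B (i + 1))) := pathBox_succ n B
      have hm := measurableSet_pathBox n fun i => hB (i + 1)
      rw [e, e', chainKernel_inter_shift κ x (hB 0) (hm.inter hA),
        chainKernel_inter_shift κ x (hB 0) hm]
      by_cases hxB : x ∈ B 0
      · rw [Set.indicator_of_mem hxB, Set.indicator_of_mem hxB, lintegral_congr_ae hx,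
          lintegral_const_mul _ (Kernel.measurable_coe _ hm)]
      · simp [hxB]
  -- Boxes determine measures, so `A` is independent of every event, in particular of itself, and
  -- its probability is `0` or `1`.
  have hres : M.restrict A = c • M := by
    refine ext_of_pathBox fun n B hB => ?_
    have hm := measurableSet_pathBox n hB
    rw [Measure.restrict_apply hm, hApply _ (hm.inter hA), lintegral_congr_ae (hbox n B hB),
      lintegral_const_mul _ (Kernel.measurable_coe _ hm), Measure.smul_apply, hApply _ hm,
      smul_eq_mul]
  have hsq : M A = c * M A := by
    conv_lhs => rw [← Set.inter_self A, ← Measure.restrict_apply hA, hres]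
    rfl
  rw [eventuallyConst_set']
  rw [hMA] at hsq
  have hc1 : c ≤ 1 := hMA ▸ prob_le_one
  rcases eq_or_ne c 0 with h0 | h0
  · left
    rw [ae_eq_empty, hMA, h0]
  · right
    have : c = 1 := by
      have h2 : c * 1 = c * c := by rw [mul_one]; exact hsq
      exact ((ENNReal.mul_right_inj h0 (hc1.trans_lt ENNReal.one_lt_top).ne).1 h2).symm
    rw [ae_eq_univ, prob_compl_eq_zero_iff hA, hMA, this]

/-- The law of large numbers for Markov chains whose initial law is absolutely continuous with
respect to an invariant measure, for which bounded harmonic functions are constant. -/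
theorem IsChain.tendsto_average (hinv : κ.Invariant Γ)
    (hharm : ∀ h : E → ℝ≥0∞, Measurable h → (∀ x, h x ≤ 1) → (∀ x, ∫⁻ y, h y ∂κ x = h x) →
      ∃ c, h =ᵐ[Γ] fun _ => c)
    {Ω : Type*} {mΩ : MeasurableSpace Ω} {μ : Measure Ω}
    [IsProbabilityMeasure μ] {ℱ : Filtration ℕ mΩ} {V : ℕ → Ω → E} (h : IsChain κ μ ℱ V)
    (hac : μ.map (V 0) ≪ Γ) {f : E → ℝ} (hf : Integrable f Γ) :
    ∀ᵐ ω ∂μ, Tendsto (fun T : ℕ => (1 / (T : ℝ)) * ∑ t ∈ Finset.range T, f (V t ω)) atTop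
      (𝓝 (∫ x, f x ∂Γ)) := by
  have hV : Measurable fun ω i => V i ω := measurable_pi_lambda _ h.measurable
  have hev : MeasurePreserving (fun p : ℕ → E => p 0) (Γ.bind (chainKernel κ)) Γ := by
    refine ⟨measurable_pi_apply 0, ?_⟩
    rw [Measure.map_comp _ _ (measurable_pi_apply 0)]
    have : (chainKernel κ).map (fun p => p 0) = Kernel.id := by
      ext1 x
      rw [Kernel.map_apply _ (measurable_pi_apply 0), chainKernel_map_zero, Kernel.id_apply]
    rw [this, Measure.id_comp]
  have hB := tendsto_birkhoffAverage_of_ergodic (ergodic_shift hinv hharm)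
    (f := fun p : ℕ → E => f (p 0)) (hev.integrable_comp_of_integrable hf)
  have hac' : μ.map (fun ω i => V i ω) ≪ Γ.bind (chainKernel κ) := by
    rw [h.map_eq]
    exact Measure.AbsolutelyContinuous.comp_right hac _
  have hint : ∫ p, f (p 0) ∂(Γ.bind (chainKernel κ)) = ∫ x, f x ∂Γ := by
    conv_rhs => rw [← hev.map_eq]
    rw [integral_map (measurable_pi_apply 0).aemeasurable]
    rw [hev.map_eq]
    exact hf.aestronglyMeasurable
  have hiter : ∀ (p : ℕ → E) k, (shift^[k] p) 0 = p k := by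
    have : ∀ k i (p : ℕ → E), (shift^[k] p) i = p (i + k) := by
      intro k
      induction k with
      | zero => intro i p; rfl
      | succ k ih =>
        intro i p
        rw [Function.iterate_succ_apply, ih]
        rfl
    intro p k
    rw [this, zero_add]
  filter_upwards [ae_of_ae_map hV.aemeasurable (hac'.ae_le hB)] with ω hω
  rw [hint] at hω
  refine hω.congr fun T => ?_
  simp [birkhoffAverage, birkhoffSum, hiter]

end MarkovChain

end AccelPT

/-! ### Product measures under kernels that act on single coordinates or on pairs of them. -/

namespace AccelPT

open scoped ENNReal

/-- On a rectangle the kernel is a product of functions of the separate coordinates, which are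
independent under a product measure. -/
theorem pi_bind_prodKernel {ι β : Type*} [Fintype ι] [MeasurableSpace β]
    (μ : ι → Measure β) [∀ i, IsProbabilityMeasure (μ i)]
    (κ : ι → Kernel β β) [∀ i, IsMarkovKernel (κ i)] :
    (Measure.pi μ).bind (prodKernel fun i => (κ i).comap (fun x => x i) (measurable_pi_apply i)) =
      Measure.pi fun i => (μ i).bind (κ i) := by
  symm
  refine Measure.pi_eq fun s hs => ?_
  have hm : ∀ i, Measurable fun x => κ i x (s i) := fun i => Kernel.measurable_coe _ (hs i)
  rw [Measure.bind_apply (MeasurableSet.univ_pi hs) (Kernel.aemeasurable _)]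
  have : ∀ y : ι → β, prodKernel (fun i => (κ i).comap (fun x : ι → β => x i)
      (measurable_pi_apply i)) y (Set.univ.pi s) = ∏ i, κ i (y i) (s i) := fun y =>
    Measure.pi_pi _ _
  simp only [this]
  rw [lintegral_prod_eq_prod_lintegral_of_indepFun Finset.univ
    (fun i (y : ι → β) => κ i (y i) (s i)) (iIndepFun_pi fun i => (hm i).aemeasurable)
    fun i => (hm i).comp (measurable_pi_apply i)]
  refine Finset.prod_congr rfl fun i _ => ?_
  rw [Measure.bind_apply (hs i) (Kernel.aemeasurable _),
    (measurePreserving_eval μ i).lintegral_comp (hm i)]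

theorem prod_bind_prod {α α' γ γ' : Type*} [MeasurableSpace α] [MeasurableSpace α']
    [MeasurableSpace γ] [MeasurableSpace γ'] (μ : Measure α) (ν : Measure α')
    [IsProbabilityMeasure μ] [IsProbabilityMeasure ν] (κ : Kernel α γ) (η : Kernel α' γ')
    [IsMarkovKernel κ] [IsMarkovKernel η] :
    (μ.prod ν).bind (κ.comap Prod.fst measurable_fst ×ₖ η.comap Prod.snd measurable_snd) =
      (μ.bind κ).prod (ν.bind η) := by
  symm
  refine Measure.prod_eq fun s t hs ht => ?_
  rw [Measure.bind_apply (hs.prod ht) (Kernel.aemeasurable _),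
    Measure.bind_apply hs (Kernel.aemeasurable _), Measure.bind_apply ht (Kernel.aemeasurable _)]
  simp only [Kernel.prod_apply, Kernel.comap_apply, Measure.prod_prod]
  exact lintegral_prod_mul (Kernel.measurable_coe _ hs).aemeasurable
    (Kernel.measurable_coe _ ht).aemeasurable

section Product

variable {ι β : Type*} [DecidableEq ι] [MeasurableSpace β]

theorem measurable_update_uncurry (j : ι) :
    Measurable fun p : β × (ι → β) => Function.update p.2 j p.1 := by
  refine measurable_pi_lambda _ fun i => ?_
  by_cases h : i = j
  · subst h; simpa using measurable_fst
  · simp only [Function.update_of_ne h]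
    fun_prop

theorem measurable_update_pair (j k : ι) :
    Measurable fun p : (ι → β) × (β × β) =>
      Function.update (Function.update p.1 j p.2.1) k p.2.2 :=
  (measurable_update_uncurry k).comp ((measurable_snd.comp measurable_snd).prodMk
    ((measurable_update_uncurry j).comp
      ((measurable_fst.comp measurable_snd).prodMk measurable_fst)))

theorem isProbabilityMeasure_update {μ : ι → Measure β} [∀ i, IsProbabilityMeasure (μ i)] (j : ι)
    (ν : Measure β) [IsProbabilityMeasure ν] (i : ι) :
    IsProbabilityMeasure (Function.update μ j ν i) := by
  by_cases h : i = j
  · subst h; simpa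
  · simpa [Function.update_of_ne h] using inferInstanceAs (IsProbabilityMeasure (μ i))

/-- Resampling the coordinates `j` and `k` by a kernel that reads only these coordinates. -/
noncomputable def liftPair (j k : ι) (τ : Kernel (β × β) (β × β)) : Kernel (ι → β) (ι → β) :=
  (Kernel.id ×ₖ τ.comap (fun y => (y j, y k)) (by fun_prop)).map
    fun p => Function.update (Function.update p.1 j p.2.1) k p.2.2

theorem liftPair_apply (j k : ι) (τ : Kernel (β × β) (β × β)) [IsMarkovKernel τ] (y : ι → β) :
    liftPair j k τ y = (τ (y j, y k)).map
      fun q => Function.update (Function.update y j q.1) k q.2 := by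
  rw [liftPair, Kernel.map_apply _ (measurable_update_pair j k), Kernel.prod_apply,
    Kernel.id_apply, Kernel.comap_apply, Measure.dirac_prod, Measure.map_map
    (measurable_update_pair j k) measurable_prodMk_left]
  rfl

instance (j k : ι) (τ : Kernel (β × β) (β × β)) [IsMarkovKernel τ] :
    IsMarkovKernel (liftPair j k τ) :=
  Kernel.IsMarkovKernel.map _ (measurable_update_pair j k)

variable [Fintype ι]

/-- A product measure does not change if a coordinate is resampled. -/
theorem pi_eq_map_update (μ : ι → Measure β) [∀ i, IsProbabilityMeasure (μ i)] (j : ι)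
    (ν : Measure β) [IsProbabilityMeasure ν] :
    Measure.pi μ = ((μ j).prod (Measure.pi (Function.update μ j ν))).map
      fun p => Function.update p.2 j p.1 := by
  have := isProbabilityMeasure_update (μ := μ) j ν
  refine Measure.pi_eq fun s hs => ?_
  have h : (fun p : β × (ι → β) => Function.update p.2 j p.1) ⁻¹' Set.univ.pi s =
      s j ×ˢ Set.univ.pi (Function.update s j Set.univ) := by
    ext p
    simp only [Set.mem_preimage, Set.mem_univ_pi, Set.mem_prod]
    constructor
    · intro h
      refine ⟨by simpa using h j, fun i => ?_⟩
      by_cases hi : i = j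
      · subst hi; simp
      · simpa [hi] using h i
    · rintro ⟨h1, h2⟩ i
      by_cases hi : i = j
      · subst hi; simpa using h1
      · simpa [hi] using h2 i
  rw [Measure.map_apply (measurable_update_uncurry j) (MeasurableSet.univ_pi hs), h,
    Measure.prod_prod, Measure.pi_pi, ← Finset.mul_prod_erase _ _ (Finset.mem_univ j),
    ← Finset.mul_prod_erase Finset.univ (fun i => (μ i) (s i)) (Finset.mem_univ j)]
  simp only [Function.update_self, measure_univ, one_mul]
  congr 1
  refine Finset.prod_congr rfl fun i hi => ?_
  rw [Function.update_of_ne (Finset.ne_of_mem_erase hi),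
    Function.update_of_ne (Finset.ne_of_mem_erase hi)]

/-- Fubini with coordinates `j` and `k` split off. The auxiliary `ν` fills these two coordinates of
the background measure, which avoids passing to an index type without `j` and `k`. -/
theorem lintegral_pi_update_pair (μ : ι → Measure β) [∀ i, IsProbabilityMeasure (μ i)] {j k : ι}
    (hjk : j ≠ k) (ν : Measure β) [IsProbabilityMeasure ν] {g : (ι → β) → ℝ≥0∞}
    (hg : Measurable g) :
    ∫⁻ y, g y ∂Measure.pi μ = ∫⁻ z, ∫⁻ q, g (Function.update (Function.update z j q.1) k q.2)
      ∂((μ j).prod (μ k)) ∂Measure.pi (Function.update (Function.update μ j ν) k ν) := by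
  have h1 := isProbabilityMeasure_update (μ := μ) j ν
  have h2 := isProbabilityMeasure_update (μ := Function.update μ j ν) k ν
  have hU := hg.comp (measurable_update_pair (β := β) j k)
  have hU1 : Measurable fun p : β × (ι → β) => g (Function.update p.2 j p.1) :=
    hg.comp (measurable_update_uncurry j)
  have hUu : Measurable (Function.uncurry fun (z : ι → β) (q : β × β) =>
      g (Function.update (Function.update z j q.1) k q.2)) := hU
  have hL : Measurable fun q : β × β => ∫⁻ z, g (Function.update (Function.update z j q.1) k q.2)
      ∂Measure.pi (Function.update (Function.update μ j ν) k ν) :=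
    Measurable.lintegral_prod_left' hU
  rw [lintegral_lintegral_swap hUu.aemeasurable, lintegral_prod _ hL.aemeasurable, pi_eq_map_update μ j ν,
    lintegral_map hg (measurable_update_uncurry j), lintegral_prod _ hU1.aemeasurable]
  refine lintegral_congr fun a => ?_
  have ha : Measurable fun z : ι → β => g (Function.update z j a) :=
    hU1.comp measurable_prodMk_left
  dsimp only
  rw [pi_eq_map_update (Function.update μ j ν) k ν, lintegral_map ha
    (measurable_update_uncurry k), Function.update_of_ne hjk.symm, lintegral_prod]
  · simp only [Function.update_comm hjk]
  · exact (ha.comp (measurable_update_uncurry k)).aemeasurable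

theorem pi_bind_liftPair (μ μ' : ι → Measure β) [∀ i, IsProbabilityMeasure (μ i)]
    [∀ i, IsProbabilityMeasure (μ' i)] {j k : ι} (hjk : j ≠ k) (τ : Kernel (β × β) (β × β))
    [IsMarkovKernel τ] (hne : ∀ i, i ≠ j → i ≠ k → μ' i = μ i)
    (h : ((μ j).prod (μ k)).bind τ = (μ' j).prod (μ' k)) :
    (Measure.pi μ).bind (liftPair j k τ) = Measure.pi μ' := by
  refine Measure.ext_of_lintegral _ fun g hg => ?_
  have hU := hg.comp (measurable_update_pair (β := β) j k)
  -- With the same filler at `j` and `k`, the background measures of `μ` and `μ'` coincide, and the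
  -- claim reduces to `h` for each fixed background state.
  have hupd : Function.update (Function.update μ' j (μ j)) k (μ j) =
      Function.update (Function.update μ j (μ j)) k (μ j) := by
    ext1 i
    by_cases hk : i = k
    · subst hk; simp
    by_cases hj : i = j
    · subst hj; simp [hk]
    simp [hk, hj, hne i hj hk]
  rw [Measure.lintegral_bind (Kernel.aemeasurable _) hg.aemeasurable,
    lintegral_pi_update_pair μ hjk (μ j) hg.lintegral_kernel,
    lintegral_pi_update_pair μ' hjk (μ j) hg, hupd]
  refine lintegral_congr fun z => ?_
  have hz : Measurable fun q : β × β => g (Function.update (Function.update z j q.1) k q.2) :=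
    hU.comp measurable_prodMk_left
  rw [← h, Measure.lintegral_bind (Kernel.aemeasurable _) hz.aemeasurable]
  refine lintegral_congr fun q => ?_
  have hm : ∀ y : ι → β, Measurable fun q : β × β =>
      Function.update (Function.update y j q.1) k q.2 := fun y =>
    (measurable_update_pair j k).comp measurable_prodMk_left
  rw [liftPair_apply, lintegral_map hg (hm _)]
  simp only [Function.update_self, Function.update_of_ne hjk]
  refine lintegral_congr fun q' => ?_
  congr 1
  ext1 i
  by_cases hk : i = k
  · subst hk; simp
  by_cases hj : i = j
  · subst hj; simp [hk]
  simp [hk, hj]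

end Product

end AccelPT

/-! ### A single swap as a kernel on the states of two chains. -/

namespace AccelPT

open scoped ENNReal

/-- A function with Dirac law is almost surely constant, hence independent of everything. -/
theorem map_prodMk_of_map_eq_dirac {α β : Type*} [MeasurableSpace α] [MeasurableSpace β]
    {m : Measure α} [IsProbabilityMeasure m] {f : α → β} (hf : Measurable f) {b : β}
    (h : m.map f = Measure.dirac b) : m.map (fun x => (f x, x)) = (Measure.dirac b).prod m := by
  symm
  refine Measure.prod_eq fun s t hs ht => ?_
  rw [Measure.map_apply (by fun_prop) (hs.prod ht)]
  have key : ∀ s, MeasurableSet s → b ∈ s → ∀ᵐ x ∂m, f x ∈ s := fun s hs hb => by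
    refine ae_of_ae_map (p := fun y => y ∈ s) hf.aemeasurable ?_
    rw [h]
    exact (ae_dirac_iff hs).2 hb
  rw [Measure.dirac_apply' _ hs]
  by_cases hb : b ∈ s
  · simp only [hb, Set.indicator_of_mem, Pi.one_apply, one_mul]
    refine measure_congr ?_
    filter_upwards [key s hs hb] with x hx
    exact propext ⟨fun h => h.2, fun h => ⟨hx, h⟩⟩
  · simp only [hb, not_false_eq_true, Set.indicator_of_notMem, zero_mul]
    have := key sᶜ hs.compl hb
    rw [ae_iff] at this
    refine measure_mono_null (fun x hx => ?_) this
    simpa using hx.1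

variable {𝓧 : Type*} [MeasurableSpace 𝓧]

theorem pathKernel_map_zero (K : ℕ) (P : Fin K → Kernel 𝓧 𝓧) [∀ k, IsMarkovKernel (P k)] (x : 𝓧) :
    (pathKernel K P x).map (fun p => p 0) = Measure.dirac x := by
  cases K with
  | zero =>
    rw [pathKernel, Kernel.deterministic_apply, Measure.map_dirac' (measurable_pi_apply 0)]
  | succ K =>
    rw [pathKernel, Kernel.map_apply _ (measurable_cons K), Measure.map_map (measurable_pi_apply 0)
      (measurable_cons K), Kernel.prod_apply, Kernel.id_apply]
    exact Measure.map_fst_prod.trans (by simp)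

theorem revPathKernel_map_last (K : ℕ) (Q : Fin K → Kernel 𝓧 𝓧) [∀ k, IsMarkovKernel (Q k)]
    (x : 𝓧) : (revPathKernel K Q x).map (fun p => p (Fin.last K)) = Measure.dirac x := by
  rw [revPathKernel, Kernel.map_apply _ (by fun_prop), Measure.map_map (measurable_pi_apply _)
    (by fun_prop), ← pathKernel_map_zero K (fun k => Q k.rev) x]
  congr 1
  ext p
  simp

theorem bind_prod_const {α β γ : Type*} [MeasurableSpace α] [MeasurableSpace β]
    [MeasurableSpace γ] (ν : Measure α) [IsProbabilityMeasure ν] (η : Kernel α β)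
    [IsMarkovKernel η] (m : Measure γ) [IsProbabilityMeasure m] :
    ν.bind (η ×ₖ Kernel.const α m) = (ν.bind η).prod m := by
  symm
  refine Measure.prod_eq fun s t hs ht => ?_
  rw [Measure.bind_apply (hs.prod ht) (Kernel.aemeasurable _),
    Measure.bind_apply hs (Kernel.aemeasurable _)]
  simp only [Kernel.prod_apply, Kernel.const_apply, Measure.prod_prod]
  exact lintegral_mul_const _ (Kernel.measurable_coe _ hs)

namespace Data

variable {N K : ℕ} (S : Data N K 𝓧)

theorem measurable_work (j : Fin N) : Measurable (S.work j) :=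
  measurable_const.sub (Measure.measurable_rnDeriv _ _).ennreal_toReal.log

theorem measurable_accept (j : Fin N) :
    Measurable fun p : Path K 𝓧 × Path K 𝓧 => S.accept j p.1 p.2 :=
  (measurable_const.min (((S.measurable_work j).comp measurable_snd).sub
    ((S.measurable_work j).comp measurable_fst))).exp

theorem accept_pos (j : Fin N) (x x' : Path K 𝓧) : 0 < S.accept j x x' := Real.exp_pos _

theorem accept_le_one (j : Fin N) (x x' : Path K 𝓧) : S.accept j x x' ≤ 1 :=
  Real.exp_le_one_iff.2 (min_le_left _ _)

theorem measurableSet_accepted (j : Fin N) : MeasurableSet {d : Draw K 𝓧 | S.Accepted j d} := by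
  have h1 : Measurable fun d : Draw K 𝓧 => (d.2.2 : ℝ) :=
    measurable_subtype_coe.comp (measurable_snd.comp measurable_snd)
  have h2 : Measurable fun d : Draw K 𝓧 => (d.1, d.2.1) := by fun_prop
  have h3 := (S.measurable_accept j).comp h2
  exact measurableSet_lt h1 h3

theorem volume_lt_accept (j : Fin N) (x x' : Path K 𝓧) :
    (volume : Measure unitInterval) {u | (u : ℝ) < S.accept j x x'} =
      ENNReal.ofReal (S.accept j x x') := by
  set a : unitInterval := ⟨S.accept j x x', (S.accept_pos j x x').le, S.accept_le_one j x x'⟩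
  exact unitInterval.volume_Iio a

/-- The draw for the swap `j`, as a function of the states of the two chains. -/
noncomputable def pairDraw (j : Fin N) : Kernel (𝓧 × 𝓧) (Draw K 𝓧) :=
  (pathKernel K (S.fwd j)).comap Prod.fst measurable_fst ×ₖ
    (revPathKernel K (S.bwd j) ×ₖ Kernel.const _ (volume : Measure unitInterval)).comap
      Prod.snd measurable_snd

instance (j : Fin N) : IsMarkovKernel (S.pairDraw j) := by unfold pairDraw; infer_instance

theorem pairDraw_apply (j : Fin N) (q : 𝓧 × 𝓧) :
    S.pairDraw j q = (pathKernel K (S.fwd j) q.1).prod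
      ((revPathKernel K (S.bwd j) q.2).prod volume) := by
  rw [pairDraw, Kernel.prod_apply, Kernel.comap_apply, Kernel.comap_apply, Kernel.prod_apply,
    Kernel.const_apply]

theorem drawKernel_apply (j : Fin N) (y : State N 𝓧) :
    S.drawKernel j y = S.pairDraw j (y j.castSucc, y j.succ) := by
  rw [pairDraw_apply, drawKernel, Kernel.prod_apply, Kernel.comap_apply, Kernel.prod_apply,
    Kernel.comap_apply, Kernel.const_apply]

open Classical in
/-- The states of the two chains after the swap `j`, if they are `q` before it. -/
noncomputable def swapPair (j : Fin N) (d : Draw K 𝓧) (q : 𝓧 × 𝓧) : 𝓧 × 𝓧 :=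
  if S.Accepted j d then (d.2.1 0, d.1 (Fin.last K)) else q

theorem measurable_swapPair (j : Fin N) :
    Measurable fun p : (𝓧 × 𝓧) × Draw K 𝓧 => S.swapPair j p.2 p.1 :=
  Measurable.ite (measurable_snd (S.measurableSet_accepted j)) (by fun_prop) measurable_fst

/-- The swap `j`, as a kernel on the states of the two chains. -/
noncomputable def pairKernel (j : Fin N) : Kernel (𝓧 × 𝓧) (𝓧 × 𝓧) :=
  (Kernel.id ×ₖ S.pairDraw j).map fun p => S.swapPair j p.2 p.1

instance (j : Fin N) : IsMarkovKernel (S.pairKernel j) :=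
  Kernel.IsMarkovKernel.map _ (S.measurable_swapPair j)

theorem pairKernel_apply (j : Fin N) (q : 𝓧 × 𝓧) :
    S.pairKernel j q = (S.pairDraw j q).map fun d => S.swapPair j d q := by
  rw [pairKernel, Kernel.map_apply _ (S.measurable_swapPair j), Kernel.prod_apply, Kernel.id_apply,
    Measure.dirac_prod, Measure.map_map (S.measurable_swapPair j) measurable_prodMk_left]
  rfl

/-- The end points of the two paths of a draw from which they were started. -/
def startPair (d : Draw K 𝓧) : 𝓧 × 𝓧 := (d.1 0, d.2.1 (Fin.last K))

theorem measurable_startPair : Measurable (startPair (K := K) (𝓧 := 𝓧)) := by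
  unfold startPair; fun_prop

theorem pairDraw_map_startPair (j : Fin N) (q : 𝓧 × 𝓧) :
    (S.pairDraw j q).map startPair = Measure.dirac q := by
  have h : startPair (K := K) (𝓧 := 𝓧) =
      Prod.map (fun p => p 0) ((fun p => p (Fin.last K)) ∘ Prod.fst) := rfl
  rw [h, pairDraw_apply, ← Measure.map_prod_map _ _ (by fun_prop) (by fun_prop),
    pathKernel_map_zero, ← Measure.map_map (by fun_prop) (by fun_prop), Measure.map_fst_prod,
    measure_univ, one_smul, revPathKernel_map_last, Measure.dirac_prod_dirac]

/-- The states before the swap are recovered as the starting points of the two paths. The result is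
then a function of the draw alone, and the stationary law of the draw suffices to compute its law.
-/
theorem pairKernel_apply_startPair (j : Fin N) (q : 𝓧 × 𝓧) :
    S.pairKernel j q = (S.pairDraw j q).map fun d => S.swapPair j d (startPair d) := by
  have h := map_prodMk_of_map_eq_dirac measurable_startPair (S.pairDraw_map_startPair j q)
  have h2 := congrArg (Measure.map fun p : (𝓧 × 𝓧) × Draw K 𝓧 => S.swapPair j p.2 p.1) h
  rw [Measure.map_map (S.measurable_swapPair j) (measurable_startPair.prodMk measurable_id')] at h2
  rw [pairKernel, Kernel.map_apply _ (S.measurable_swapPair j), Kernel.prod_apply, Kernel.id_apply,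
    ← h2]
  rfl

/-- The kernel that carries out the swap `j` regardless of the acceptance probability. -/
noncomputable def forcedKernel (j : Fin N) : Kernel (𝓧 × 𝓧) (𝓧 × 𝓧) :=
  (((pathKernel K (S.fwd j)).map fun p => p (Fin.last K)).comap Prod.fst measurable_fst ×ₖ
    ((revPathKernel K (S.bwd j)).map fun p => p 0).comap Prod.snd measurable_snd).map Prod.swap

theorem isMarkovKernel_eval (κ : Kernel 𝓧 (Path K 𝓧)) [IsMarkovKernel κ] (i : Fin (K + 1)) :
    IsMarkovKernel (κ.map fun p => p i) :=
  Kernel.IsMarkovKernel.map _ (measurable_pi_apply i)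

instance (j : Fin N) : IsMarkovKernel (S.forcedKernel j) := by
  have := isMarkovKernel_eval (pathKernel K (S.fwd j)) (Fin.last K)
  have := isMarkovKernel_eval (revPathKernel K (S.bwd j)) 0
  exact Kernel.IsMarkovKernel.map _ measurable_swap

/-- Unlike the true swap, the forced one maps product measures to product measures, because no
acceptance decision couples the two paths. -/
theorem prod_bind_forcedKernel (j : Fin N) (μ ν : Measure 𝓧) [IsProbabilityMeasure μ]
    [IsProbabilityMeasure ν] :
    (μ.prod ν).bind (S.forcedKernel j) =
      ((ν.bind (revPathKernel K (S.bwd j))).map fun p => p 0).prod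
        ((μ.bind (pathKernel K (S.fwd j))).map fun p => p (Fin.last K)) := by
  have := isMarkovKernel_eval (pathKernel K (S.fwd j)) (Fin.last K)
  have := isMarkovKernel_eval (revPathKernel K (S.bwd j)) 0
  rw [forcedKernel, ← Measure.map_comp _ _ measurable_swap, prod_bind_prod, Measure.prod_swap,
    Measure.map_comp _ _ (measurable_pi_apply _), Measure.map_comp _ _ (measurable_pi_apply _)]

/-- Each pair of paths is accepted with positive probability, so a set that the true swap misses is
missed by almost every forced exchange. -/
theorem forcedKernel_ac_pairKernel (j : Fin N) (q : 𝓧 × 𝓧) :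
    S.forcedKernel j q ≪ S.pairKernel j q := by
  refine Measure.AbsolutelyContinuous.mk fun C hC h0 => ?_
  have := isMarkovKernel_eval (pathKernel K (S.fwd j)) (Fin.last K)
  have := isMarkovKernel_eval (revPathKernel K (S.bwd j)) 0
  set A := pathKernel K (S.fwd j) q.1
  set B := revPathKernel K (S.bwd j) q.2
  have hsw : Measurable fun d : Draw K 𝓧 => S.swapPair j d q :=
    (S.measurable_swapPair j).comp measurable_prodMk_left
  rw [pairKernel_apply, Measure.map_apply hsw hC, pairDraw_apply,
    Measure.measure_prod_null (hsw hC)] at h0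
  have hG : Measurable fun p : Path K 𝓧 × Path K 𝓧 => (p.2 0, p.1 (Fin.last K)) := by fun_prop
  have h1 : S.forcedKernel j q = (A.prod B).map fun p => (p.2 0, p.1 (Fin.last K)) := by
    rw [forcedKernel, Kernel.map_apply _ measurable_swap, Kernel.prod_apply, Kernel.comap_apply,
      Kernel.comap_apply, Kernel.map_apply _ (measurable_pi_apply _),
      Kernel.map_apply _ (measurable_pi_apply _), Measure.map_prod_map _ _
      (measurable_pi_apply _) (measurable_pi_apply _), Measure.map_map measurable_swap
      (by fun_prop)]
    rfl
  rw [h1, Measure.map_apply hG hC, Measure.measure_prod_null (hG hC)]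
  filter_upwards [h0] with x hx
  have hm : MeasurableSet (Prod.mk x ⁻¹' ((fun d : Draw K 𝓧 => S.swapPair j d q) ⁻¹' C)) :=
    measurable_prodMk_left (hsw hC)
  rw [Pi.zero_apply, Measure.measure_prod_null hm] at hx
  rw [Pi.zero_apply]
  refine measure_mono_null_ae ?_ (measure_empty (μ := B))
  filter_upwards [hx] with x' hx' hmem
  refine absurd hx' (ne_of_gt ?_)
  refine lt_of_lt_of_le (ENNReal.ofReal_pos.2 (S.accept_pos j x x')) ?_
  rw [← S.volume_lt_accept j x x']
  refine measure_mono fun u hu => ?_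
  have hacc : S.Accepted j (x, x', u) := hu
  have hmem' : (x' 0, x (Fin.last K)) ∈ C := hmem
  simpa [swapPair, hacc] using hmem'

end Data

end AccelPT

/-! ### Invariance of the swap: detailed balance on path space. -/

namespace AccelPT

open scoped ENNReal

namespace Data

variable {𝓧 : Type*} [MeasurableSpace 𝓧] {N K : ℕ} {S : Data N K 𝓧}

theorem Valid.isProbabilityMeasure_π (hS : S.Valid) (n : Fin (N + 1)) :
    IsProbabilityMeasure (S.π n) := by
  have : NeZero S.base := ⟨hS.base_ne_zero⟩
  exact isProbabilityMeasure_tilted (hS.integrable_exp n)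

theorem Valid.isProbabilityMeasure_fwdLaw (hS : S.Valid) (j : Fin N) :
    IsProbabilityMeasure (S.fwdLaw j) := by
  have := hS.isProbabilityMeasure_π j.castSucc
  unfold fwdLaw; infer_instance

theorem Valid.isProbabilityMeasure_bwdLaw (hS : S.Valid) (j : Fin N) :
    IsProbabilityMeasure (S.bwdLaw j) := by
  have := hS.isProbabilityMeasure_π j.succ
  unfold bwdLaw; infer_instance

theorem fwdLaw_map_zero (S : Data N K 𝓧) (j : Fin N) :
    (S.fwdLaw j).map (fun p => p 0) = S.π j.castSucc := by
  have : (pathKernel K (S.fwd j)).map (fun p => p 0) = Kernel.id := by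
    ext1 x
    rw [Kernel.map_apply _ (measurable_pi_apply 0), pathKernel_map_zero, Kernel.id_apply]
  rw [fwdLaw, Measure.map_comp _ _ (measurable_pi_apply 0), this, Measure.id_comp]

theorem bwdLaw_map_last (S : Data N K 𝓧) (j : Fin N) :
    (S.bwdLaw j).map (fun p => p (Fin.last K)) = S.π j.succ := by
  have : (revPathKernel K (S.bwd j)).map (fun p => p (Fin.last K)) = Kernel.id := by
    ext1 x
    rw [Kernel.map_apply _ (measurable_pi_apply _), revPathKernel_map_last, Kernel.id_apply]
  rw [bwdLaw, Measure.map_comp _ _ (measurable_pi_apply _), this, Measure.id_comp]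

theorem Valid.prod_bind_pairDraw (hS : S.Valid) (j : Fin N) :
    ((S.π j.castSucc).prod (S.π j.succ)).bind (S.pairDraw j) =
      (S.fwdLaw j).prod ((S.bwdLaw j).prod volume) := by
  have := hS.isProbabilityMeasure_π
  rw [pairDraw, prod_bind_prod, bind_prod_const, fwdLaw, bwdLaw]

theorem Valid.ae_rnDeriv_pos_lt_top (hS : S.Valid) (j : Fin N) :
    ∀ᵐ x ∂S.fwdLaw j, 0 < (S.bwdLaw j).rnDeriv (S.fwdLaw j) x ∧
      (S.bwdLaw j).rnDeriv (S.fwdLaw j) x < ∞ := by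
  have := hS.isProbabilityMeasure_fwdLaw j
  have := hS.isProbabilityMeasure_bwdLaw j
  filter_upwards [Measure.rnDeriv_pos' (hS.fwd_ac_bwd j),
    Measure.rnDeriv_lt_top (S.bwdLaw j) (S.fwdLaw j)] with x h1 h2 using ⟨h1, h2⟩

/-- The free energy cancels in the difference of works, which leaves the Metropolis ratio `min 1 (ρ
x / ρ x')`. Positivity and finiteness of the densities make the real logarithm faithful. -/
theorem rnDeriv_mul_accept (S : Data N K 𝓧) (j : Fin N) {x x' : Path K 𝓧}
    (h : 0 < (S.bwdLaw j).rnDeriv (S.fwdLaw j) x ∧ (S.bwdLaw j).rnDeriv (S.fwdLaw j) x < ∞)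
    (h' : 0 < (S.bwdLaw j).rnDeriv (S.fwdLaw j) x' ∧ (S.bwdLaw j).rnDeriv (S.fwdLaw j) x' < ∞) :
    (S.bwdLaw j).rnDeriv (S.fwdLaw j) x' * ENNReal.ofReal (S.accept j x x') =
      min ((S.bwdLaw j).rnDeriv (S.fwdLaw j) x) ((S.bwdLaw j).rnDeriv (S.fwdLaw j) x') := by
  unfold accept work
  generalize (S.bwdLaw j).rnDeriv (S.fwdLaw j) x = r at h ⊢
  generalize (S.bwdLaw j).rnDeriv (S.fwdLaw j) x' = r' at h' ⊢
  lift r to NNReal using h.2.ne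
  lift r' to NNReal using h'.2.ne
  have hr : (0 : ℝ) < r := by simpa using h.1
  have hr' : (0 : ℝ) < r' := by simpa using h'.1
  simp only [ENNReal.coe_toReal]
  have e : Real.exp (min 0 (S.ΔFstep j - Real.log r' - (S.ΔFstep j - Real.log r))) =
      min 1 ((r : ℝ) / r') := by
    rw [Real.exp_monotone.map_min, Real.exp_zero]
    congr 1
    rw [sub_sub_sub_cancel_left, Real.exp_sub, Real.exp_log hr, Real.exp_log hr']
  rw [e, ← ENNReal.ofReal_coe_nnreal (p := r'), ← ENNReal.ofReal_mul hr'.le,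
    ← ENNReal.ofReal_coe_nnreal (p := r), ← ENNReal.ofReal_min, mul_min_of_nonneg _ _ hr'.le,
    mul_one, mul_div_cancel₀ _ hr'.ne', min_comm]

theorem volume_swapPair (S : Data N K 𝓧) (j : Fin N) (x x' : Path K 𝓧) (C : Set (𝓧 × 𝓧)) :
    (volume : Measure unitInterval) {u | S.swapPair j (x, x', u) (startPair (x, x', u)) ∈ C} =
      ENNReal.ofReal (S.accept j x x') * C.indicator 1 (x' 0, x (Fin.last K)) +
        (1 - ENNReal.ofReal (S.accept j x x')) * C.indicator 1 (x 0, x' (Fin.last K)) := by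
  set V : Set unitInterval := {u | (u : ℝ) < S.accept j x x'} with hV
  have hVm : MeasurableSet V := measurableSet_lt measurable_subtype_coe measurable_const
  have h1 : volume V = ENNReal.ofReal (S.accept j x x') := S.volume_lt_accept j x x'
  have h2 : volume Vᶜ = 1 - ENNReal.ofReal (S.accept j x x') := by
    rw [prob_compl_eq_one_sub hVm, h1]
  have hset : {u | S.swapPair j (x, x', u) (startPair (x, x', u)) ∈ C} =
      (V ∩ {_u | (x' 0, x (Fin.last K)) ∈ C}) ∪ (Vᶜ ∩ {_u | (x 0, x' (Fin.last K)) ∈ C}) := by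
    ext u
    by_cases hu : u ∈ V
    · have : S.Accepted j (x, x', u) := hu
      simp [swapPair, this, hu]
    · have : ¬ S.Accepted j (x, x', u) := hu
      simp [swapPair, this, hu, startPair]
  rw [hset]
  by_cases c1 : (x' 0, x (Fin.last K)) ∈ C <;> by_cases c0 : (x 0, x' (Fin.last K)) ∈ C
  · simp only [c1, c0, Set.ofPred_true, Set.inter_univ, Set.union_compl_self, measure_univ,
      Set.indicator_of_mem, Pi.one_apply, mul_one]
    exact (add_tsub_cancel_of_le (ENNReal.ofReal_le_one.2 (S.accept_le_one j x x'))).symm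
  · simp [c1, c0, h1]
  · simp [c1, c0, h2]
  · simp [c1, c0]

/-- The uniform variable is integrated out, giving an accepted and a rejected part under `P ⊗ Q`. By
detailed balance the accepted part does not change if the exchanged end points are replaced by the
original ones; the weights then add up to `1`, and the end points `x 0`, `x' K` have the original
laws. -/
theorem Valid.prod_bind_pairKernel (hS : S.Valid) (j : Fin N) :
    ((S.π j.castSucc).prod (S.π j.succ)).bind (S.pairKernel j) =
      (S.π j.castSucc).prod (S.π j.succ) := by
  have := hS.isProbabilityMeasure_π
  have hP := hS.isProbabilityMeasure_fwdLaw j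
  have hQ := hS.isProbabilityMeasure_bwdLaw j
  set P := S.fwdLaw j with hPdef
  set Q := S.bwdLaw j with hQdef
  set ρ := Q.rnDeriv P with hρ
  have hρm : Measurable ρ := Measure.measurable_rnDeriv _ _
  have hQρ : Q = P.withDensity ρ := (Measure.withDensity_rnDeriv_eq _ _ (hS.bwd_ac_fwd j)).symm
  have hsw : Measurable fun d : Draw K 𝓧 => S.swapPair j d (startPair d) :=
    (S.measurable_swapPair j).comp (measurable_startPair.prodMk measurable_id)
  have hker : S.pairKernel j = (S.pairDraw j).map fun d => S.swapPair j d (startPair d) := by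
    ext1 q
    rw [S.pairKernel_apply_startPair, Kernel.map_apply _ hsw]
  rw [hker, ← Measure.map_comp _ _ hsw, hS.prod_bind_pairDraw]
  ext C hC
  set a : Path K 𝓧 → Path K 𝓧 → ℝ≥0∞ := fun x x' => ENNReal.ofReal (S.accept j x x') with ha
  have ham : Measurable (Function.uncurry a) := (S.measurable_accept j).ennreal_ofReal
  have ha1 : ∀ x x', a x x' ≤ 1 := fun x x' => ENNReal.ofReal_le_one.2 (S.accept_le_one j x x')
  set c : Path K 𝓧 → Path K 𝓧 → ℝ≥0∞ :=
    fun x x' => C.indicator 1 (x 0, x' (Fin.last K)) with hc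
  have hcm : Measurable (Function.uncurry c) := by
    have h1 : Measurable (C.indicator (1 : 𝓧 × 𝓧 → ℝ≥0∞)) := measurable_one.indicator hC
    have h2 : Measurable fun p : Path K 𝓧 × Path K 𝓧 => (p.1 0, p.2 (Fin.last K)) := by fun_prop
    exact h1.comp h2
  have hcm' : Measurable (Function.uncurry fun x x' => c x' x) := hcm.comp measurable_swap
  have hsec : ∀ {f : Path K 𝓧 → Path K 𝓧 → ℝ≥0∞}, Measurable (Function.uncurry f) →
      ∀ x, Measurable (f x) := fun hf x => hf.comp measurable_prodMk_left
  have hmulm : ∀ {f : Path K 𝓧 → Path K 𝓧 → ℝ≥0∞}, Measurable (Function.uncurry f) →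
      Measurable (Function.uncurry fun x x' => a x x' * f x x') := fun hf => ham.mul hf
  have hbal : ∫⁻ x, ∫⁻ x', a x x' * c x' x ∂Q ∂P = ∫⁻ x, ∫⁻ x', a x x' * c x x' ∂Q ∂P := by
    have hdens : ∀ f : Path K 𝓧 → Path K 𝓧 → ℝ≥0∞, Measurable (Function.uncurry f) →
        -- Relative to `P ⊗ P`, accepted pairs have the symmetric density `min (ρ x) (ρ x')`;
        -- swapping the order of integration therefore exchanges `x` and `x'` for free.
        ∫⁻ x, ∫⁻ x', a x x' * f x x' ∂Q ∂P =
          ∫⁻ x, ∫⁻ x', min (ρ x) (ρ x') * f x x' ∂P ∂P := by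
      intro f hf
      refine lintegral_congr_ae ?_
      filter_upwards [hS.ae_rnDeriv_pos_lt_top j] with x hx
      rw [hQρ, lintegral_withDensity_eq_lintegral_mul _ hρm (hsec (hmulm hf) x)]
      refine lintegral_congr_ae ?_
      filter_upwards [hS.ae_rnDeriv_pos_lt_top j] with x' hx'
      rw [Pi.mul_apply, ← mul_assoc, S.rnDeriv_mul_accept j hx hx']
    have hmin : Measurable (Function.uncurry fun x x' => min (ρ x) (ρ x')) :=
      (hρm.comp measurable_fst).min (hρm.comp measurable_snd)
    rw [hdens _ hcm', hdens _ hcm, lintegral_lintegral_swap (hmin.mul hcm').aemeasurable]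
    simp only [min_comm]
  calc ((P.prod (Q.prod volume)).map fun d => S.swapPair j d (startPair d)) C
      = ∫⁻ x, ∫⁻ x', (a x x' * c x' x + (1 - a x x') * c x x') ∂Q ∂P := by
        rw [Measure.map_apply hsw hC, Measure.prod_apply (hsw hC)]
        refine lintegral_congr fun x => ?_
        rw [Measure.prod_apply (measurable_prodMk_left (hsw hC))]
        exact lintegral_congr fun x' => S.volume_swapPair j x x' C
    _ = ∫⁻ x, ∫⁻ x', (a x x' * c x x' + (1 - a x x') * c x x') ∂Q ∂P := by
        have hsplit : ∀ f : Path K 𝓧 → Path K 𝓧 → ℝ≥0∞, Measurable (Function.uncurry f) →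
            ∫⁻ x, ∫⁻ x', (a x x' * f x x' + (1 - a x x') * c x x') ∂Q ∂P =
              ∫⁻ x, ∫⁻ x', a x x' * f x x' ∂Q ∂P +
                ∫⁻ x, ∫⁻ x', (1 - a x x') * c x x' ∂Q ∂P := by
          intro f hf
          have hL : Measurable fun x => ∫⁻ x', a x x' * f x x' ∂Q :=
            Measurable.lintegral_prod_right' (hmulm hf)
          rw [← lintegral_add_left hL]
          exact lintegral_congr fun x => lintegral_add_left (hsec (hmulm hf) x) _
        rw [hsplit _ hcm', hsplit _ hcm, hbal]
    _ = ∫⁻ x, ∫⁻ x', c x x' ∂Q ∂P := by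
        refine lintegral_congr fun x => lintegral_congr fun x' => ?_
        rw [← add_mul, add_tsub_cancel_of_le (ha1 x x'), one_mul]
    _ = ((S.π j.castSucc).prod (S.π j.succ)) C := by
        have hm : Measurable (Prod.map (fun p : Path K 𝓧 => p 0)
          fun p : Path K 𝓧 => p (Fin.last K)) := by fun_prop
        rw [← S.fwdLaw_map_zero j, ← S.bwdLaw_map_last j, Measure.map_prod_map _ _
          (measurable_pi_apply _) (measurable_pi_apply _), Measure.map_apply hm hC,
          ← lintegral_indicator_one (hm hC), lintegral_prod _
          (measurable_one.indicator (hm hC)).aemeasurable]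
        rfl

end Data

end AccelPT

/-! ### Simultaneous swaps as a composition of single ones, and the kernel of one iteration. -/

namespace AccelPT

open scoped ENNReal

/-- The swaps `i` and `j` involve different chains. -/
def Apart {N : ℕ} (i j : Fin N) : Prop :=
  i.castSucc ≠ j.castSucc ∧ i.castSucc ≠ j.succ ∧ i.succ ≠ j.castSucc ∧ i.succ ≠ j.succ

/-- The swaps proposed at iteration `t`. -/
def propList (N t : ℕ) : List (Fin N) := (List.finRange N).filter fun j => Proposed t j

theorem mem_propList {N t : ℕ} {j : Fin N} : j ∈ propList N t ↔ Proposed t j := by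
  simp [propList]

/-- Distinct indices of equal parity differ by at least `2`, so the pairs of neighbouring chains are
disjoint. -/
theorem pairwise_apart_propList (N t : ℕ) : (propList N t).Pairwise Apart := by
  have h : (propList N t).Nodup := (List.nodup_finRange N).filter _
  refine (List.Pairwise.and_mem.1 h).imp ?_
  rintro i j ⟨hi, hj, hij⟩
  rw [mem_propList, Proposed, Nat.ModEq] at hi hj
  have hij' : (i : ℕ) ≠ j := fun h => hij (Fin.ext h)
  simp only [Apart, ne_eq, Fin.ext_iff, Fin.val_castSucc, Fin.val_succ]
  omega

/-- An iteration depends on `t` through its parity only, which permits replacing `t` by `0` or `1`.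
-/
theorem bodd_toNat_modEq (t : ℕ) : t.bodd.toNat ≡ t [MOD 2] := by
  have h := Nat.mod_two_of_bodd t
  rw [Nat.ModEq, h]
  cases t.bodd <;> rfl

theorem propList_bodd (N t : ℕ) : propList N t.bodd.toNat = propList N t := by
  refine List.filter_congr fun j _ => decide_eq_decide.2 ?_
  exact ⟨fun h => h.trans (bodd_toNat_modEq t), fun h => h.trans (bodd_toNat_modEq t).symm⟩

namespace Data

variable {𝓧 : Type*} [MeasurableSpace 𝓧] {N K : ℕ} (S : Data N K 𝓧)

/-- The state after the swap `j` with draw `d`. -/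
noncomputable def swapState (j : Fin N) (d : Draw K 𝓧) (y : State N 𝓧) : State N 𝓧 :=
  Function.update (Function.update y j.castSucc (S.swapPair j d (y j.castSucc, y j.succ)).1)
    j.succ (S.swapPair j d (y j.castSucc, y j.succ)).2

theorem swapState_of_ne (j : Fin N) (d : Draw K 𝓧) (y : State N 𝓧) {i : Fin (N + 1)}
    (h1 : i ≠ j.castSucc) (h2 : i ≠ j.succ) : S.swapState j d y i = y i := by
  rw [swapState, Function.update_of_ne h2, Function.update_of_ne h1]

theorem castSucc_ne_succ (j : Fin N) : j.castSucc ≠ j.succ := (Fin.castSucc_lt_succ).ne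

theorem swapState_castSucc (j : Fin N) (d : Draw K 𝓧) (y : State N 𝓧) :
    S.swapState j d y j.castSucc = (S.swapPair j d (y j.castSucc, y j.succ)).1 := by
  rw [swapState, Function.update_of_ne (castSucc_ne_succ j), Function.update_self]

theorem swapState_succ (j : Fin N) (d : Draw K 𝓧) (y : State N 𝓧) :
    S.swapState j d y j.succ = (S.swapPair j d (y j.castSucc, y j.succ)).2 := by
  rw [swapState, Function.update_self]

theorem measurable_swapState (j : Fin N) :
    Measurable fun p : State N 𝓧 × Draw K 𝓧 => S.swapState j p.2 p.1 := by
  have h1 : Measurable fun p : State N 𝓧 × Draw K 𝓧 => ((p.1 j.castSucc, p.1 j.succ), p.2) := by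
    fun_prop
  exact (measurable_update_pair j.castSucc j.succ).comp
    (measurable_fst.prodMk ((S.measurable_swapPair j).comp h1))

/-- The swap `j`, as a kernel on states. -/
noncomputable def swapKernel (j : Fin N) : Kernel (State N 𝓧) (State N 𝓧) :=
  liftPair j.castSucc j.succ (S.pairKernel j)

instance (j : Fin N) : IsMarkovKernel (S.swapKernel j) := by unfold swapKernel; infer_instance

theorem swapKernel_apply (j : Fin N) (y : State N 𝓧) :
    S.swapKernel j y = (S.drawKernel j y).map fun d => S.swapState j d y := by
  have h1 : Measurable fun d : Draw K 𝓧 => S.swapPair j d (y j.castSucc, y j.succ) :=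
    (S.measurable_swapPair j).comp measurable_prodMk_left
  have h2 : Measurable fun q : 𝓧 × 𝓧 =>
      Function.update (Function.update y j.castSucc q.1) j.succ q.2 :=
    (measurable_update_pair j.castSucc j.succ).comp measurable_prodMk_left
  rw [swapKernel, liftPair_apply, pairKernel_apply, drawKernel_apply, Measure.map_map h2 h1]
  rfl

/-- The state after carrying out a list of swaps. -/
noncomputable def swapAll : List (Fin N) → (Fin N → Draw K 𝓧) → State N 𝓧 → State N 𝓧
  | [], _, y => y
  | j :: l, d, y => swapAll l d (S.swapState j (d j) y)

theorem measurable_swapAll (l : List (Fin N)) :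
    Measurable fun p : State N 𝓧 × (Fin N → Draw K 𝓧) => S.swapAll l p.2 p.1 := by
  induction l with
  | nil => exact measurable_fst
  | cons j l ih =>
    have h1 : Measurable fun p : State N 𝓧 × (Fin N → Draw K 𝓧) => (p.1, p.2 j) := by fun_prop
    exact ih.comp (((S.measurable_swapState j).comp h1).prodMk measurable_snd)

theorem swapAll_congr {l : List (Fin N)} {d d' : Fin N → Draw K 𝓧} (h : ∀ j ∈ l, d j = d' j)
    (y : State N 𝓧) : S.swapAll l d y = S.swapAll l d' y := by
  induction l generalizing y with
  | nil => rfl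
  | cons k l ih =>
    rw [List.forall_mem_cons] at h
    rw [swapAll, swapAll, h.1, ih h.2]

theorem swapAll_update_of_notMem {l : List (Fin N)} {j : Fin N} (hj : j ∉ l)
    (d : Fin N → Draw K 𝓧) (e : Draw K 𝓧) (y : State N 𝓧) :
    S.swapAll l (Function.update d j e) y = S.swapAll l d y :=
  S.swapAll_congr (fun _ hi => Function.update_of_ne (ne_of_mem_of_not_mem hi hj) e d) y

theorem swapAll_of_ne {l : List (Fin N)} (d : Fin N → Draw K 𝓧) (y : State N 𝓧)
    {i : Fin (N + 1)} (h : ∀ j ∈ l, i ≠ j.castSucc ∧ i ≠ j.succ) : S.swapAll l d y i = y i := by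
  induction l generalizing y with
  | nil => rfl
  | cons k l ih =>
    rw [List.forall_mem_cons] at h
    rw [swapAll, ih _ h.2, S.swapState_of_ne k _ _ h.1.1 h.1.2]

theorem swapAll_pair {l : List (Fin N)} (hl : l.Pairwise Apart) (d : Fin N → Draw K 𝓧)
    (y : State N 𝓧) {j : Fin N} (hj : j ∈ l) :
    S.swapAll l d y j.castSucc = (S.swapPair j (d j) (y j.castSucc, y j.succ)).1 ∧
      S.swapAll l d y j.succ = (S.swapPair j (d j) (y j.castSucc, y j.succ)).2 := by
  induction l generalizing y with
  | nil => simp at hj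
  | cons k l ih =>
    rw [List.pairwise_cons] at hl
    rw [swapAll]
    rcases List.mem_cons.1 hj with rfl | hj
    · rw [S.swapAll_of_ne, S.swapAll_of_ne, swapState_castSucc, swapState_succ]
      · exact ⟨rfl, rfl⟩
      · exact fun i hi => ⟨(hl.1 i hi).2.2.1, (hl.1 i hi).2.2.2⟩
      · exact fun i hi => ⟨(hl.1 i hi).1, (hl.1 i hi).2.1⟩
    · obtain ⟨h1, h2, h3, h4⟩ := hl.1 j hj
      have := ih hl.2 (S.swapState k (d k) y) hj
      rwa [S.swapState_of_ne k _ y h1.symm h3.symm, S.swapState_of_ne k _ y h2.symm h4.symm] at this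

/-- Each chain belongs to at most one proposed swap, as its upper member, as its lower member, or
not at all; these are the three branches of `communicate`. -/
theorem communicate_eq_swapAll (t : ℕ) (y : State N 𝓧) (d : Fin N → Draw K 𝓧) :
    S.communicate t y d = S.swapAll (propList N t) d y := by
  have hl := pairwise_apart_propList N t
  ext1 i
  unfold communicate
  by_cases h1 : 0 < (i : ℕ) ∧ (i : ℕ) ≡ t [MOD 2]
  · rw [dif_pos h1]
    obtain ⟨j, rfl⟩ := Fin.exists_succ_eq.2 (Fin.pos_iff_ne_zero.1 h1.1)
    rw [(S.swapAll_pair hl d y (mem_propList.2 h1.2)).2, swapPair, apply_ite Prod.snd]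
    rfl
  rw [dif_neg h1]
  by_cases h2 : (i : ℕ) < N ∧ (i : ℕ) + 1 ≡ t [MOD 2]
  · rw [dif_pos h2]
    obtain ⟨j, rfl⟩ : ∃ j : Fin N, j.castSucc = i := ⟨⟨i, h2.1⟩, rfl⟩
    rw [(S.swapAll_pair hl d y (mem_propList.2 h2.2)).1, swapPair, apply_ite Prod.fst]
    rfl
  rw [dif_neg h2, S.swapAll_of_ne]
  intro j hj
  rw [mem_propList, Proposed] at hj
  constructor
  · rintro rfl
    exact h2 ⟨j.2, hj⟩
  · rintro rfl
    exact h1 ⟨by simp, hj⟩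

/-- The draw for the swap `j` if it is in the list `l`, and a constant otherwise. -/
noncomputable def drawOr (d₀ : Draw K 𝓧) (l : List (Fin N)) (j : Fin N) :
    Kernel (State N 𝓧) (Draw K 𝓧) :=
  if j ∈ l then S.drawKernel j else Kernel.const _ (Measure.dirac d₀)

instance (d₀ : Draw K 𝓧) (l : List (Fin N)) (j : Fin N) : IsMarkovKernel (S.drawOr d₀ l j) := by
  unfold drawOr; split_ifs <;> infer_instance

/-- The draws for the swaps in the list `l`. -/
noncomputable def listDraw (d₀ : Draw K 𝓧) (l : List (Fin N)) :
    Kernel (State N 𝓧) (Fin N → Draw K 𝓧) :=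
  prodKernel (S.drawOr d₀ l)

instance (d₀ : Draw K 𝓧) (l : List (Fin N)) : IsMarkovKernel (S.listDraw d₀ l) := by
  unfold listDraw; infer_instance

theorem listDraw_apply (d₀ : Draw K 𝓧) (l : List (Fin N)) (y : State N 𝓧) :
    S.listDraw d₀ l y = Measure.pi fun j => S.drawOr d₀ l j y := rfl

/-- The composition of the swaps in the list `l`. -/
noncomputable def swapSeq : List (Fin N) → Kernel (State N 𝓧) (State N 𝓧)
  | [] => Kernel.id
  | j :: l => swapSeq l ∘ₖ S.swapKernel j

instance isMarkovKernel_swapSeq : (l : List (Fin N)) → IsMarkovKernel (S.swapSeq l)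
  | [] => by unfold swapSeq; infer_instance
  | j :: l => by
    have := isMarkovKernel_swapSeq l
    unfold swapSeq; infer_instance

/-- The later draws read only chains that the swap `j` does not touch. -/
theorem listDraw_swapState (d₀ : Draw K 𝓧) {l : List (Fin N)} {j : Fin N}
    (h : ∀ i ∈ l, Apart j i) (e : Draw K 𝓧) (y : State N 𝓧) :
    S.listDraw d₀ l (S.swapState j e y) = S.listDraw d₀ l y := by
  rw [listDraw_apply, listDraw_apply]
  congr 1
  ext1 i
  unfold drawOr
  split_ifs with hi
  · obtain ⟨h1, h2, h3, h4⟩ := h i hi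
    rw [drawKernel_apply, drawKernel_apply, S.swapState_of_ne j _ y h1.symm h3.symm,
      S.swapState_of_ne j _ y h2.symm h4.symm]
  · rfl

/-- Carrying out simultaneously drawn swaps amounts to carrying out one after the other. -/
theorem listDraw_map_swapAll (d₀ : Draw K 𝓧) {l : List (Fin N)} (hl : l.Pairwise Apart)
    (y : State N 𝓧) :
    (S.listDraw d₀ l y).map (fun d => S.swapAll l d y) = S.swapSeq l y := by
  induction l generalizing y with
  | nil =>
    rw [swapSeq, Kernel.id_apply]
    simp only [swapAll]
    rw [Measure.map_const, measure_univ, one_smul]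
  | cons j l ih =>
    rw [List.pairwise_cons] at hl
    have hjl : j ∉ l := fun h => (hl.1 j h).1 rfl
    have hupd : Function.update (fun i => S.drawOr d₀ (j :: l) i y) j (Measure.dirac d₀) =
        fun i => S.drawOr d₀ l i y := by
      ext1 i
      by_cases hi : i = j
      · subst hi
        simp [drawOr, hjl]
      · simp [drawOr, hi]
    have hj : S.drawOr d₀ (j :: l) j y = S.drawKernel j y := by simp [drawOr]
    have hm : ∀ l (z : State N 𝓧), Measurable fun d : Fin N → Draw K 𝓧 => S.swapAll l d z :=
      fun l z => (S.measurable_swapAll l).comp measurable_prodMk_left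
    have hmj : Measurable fun e : Draw K 𝓧 => S.swapState j e y :=
      (S.measurable_swapState j).comp measurable_prodMk_left
    have hfun : (fun d => S.swapAll (j :: l) d y) ∘
        (fun p : Draw K 𝓧 × (Fin N → Draw K 𝓧) => Function.update p.2 j p.1) =
        fun p => S.swapAll l p.2 (S.swapState j p.1 y) := by
      ext1 p
      simp only [Function.comp_apply, swapAll, Function.update_self,
        S.swapAll_update_of_notMem hjl]
    have hmp : Measurable fun p : Draw K 𝓧 × (Fin N → Draw K 𝓧) =>
        S.swapAll l p.2 (S.swapState j p.1 y) :=
      (S.measurable_swapAll l).comp ((hmj.comp measurable_fst).prodMk measurable_snd)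
    -- The draw for `j` is split off by independence; the filler `dirac d₀` in its place gives
    -- exactly the law of the draws for the shorter list.
    rw [listDraw_apply, pi_eq_map_update _ j (Measure.dirac d₀), hupd, hj, Measure.map_map (hm _ y)
      (measurable_update_uncurry j), hfun, ← listDraw_apply]
    ext C hC
    rw [Measure.map_apply hmp hC, Measure.prod_apply (hmp hC), swapSeq, Kernel.comp_apply' _ _ _ hC,
      swapKernel_apply, lintegral_map (Kernel.measurable_coe _ hC) hmj]
    refine lintegral_congr fun e => ?_
    rw [← ih hl.2, Measure.map_apply (hm _ _) hC, S.listDraw_swapState d₀ hl.1]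
    rfl

/-- One iteration, as a kernel on states. -/
noncomputable def stateKernel (t : ℕ) : Kernel (State N 𝓧) (State N 𝓧) :=
  S.swapSeq (propList N t) ∘ₖ S.exploreKernel

instance : IsMarkovKernel S.exploreKernel := by unfold exploreKernel; infer_instance

instance (t : ℕ) : IsMarkovKernel (S.stateKernel t) := by unfold stateKernel; infer_instance

/-- All the sampling of iteration `t`, with a constant in place of the draws for the swaps that are
not proposed. -/
noncomputable def fullKernel (d₀ : Draw K 𝓧) (t : ℕ) :
    Kernel (State N 𝓧) (State N 𝓧 × (Fin N → Draw K 𝓧)) :=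
  S.exploreKernel ⊗ₖ Kernel.prodMkLeft _ (S.listDraw d₀ (propList N t))

instance (d₀ : Draw K 𝓧) (t : ℕ) : IsMarkovKernel (S.fullKernel d₀ t) := by
  unfold fullKernel; infer_instance

theorem measurable_communicate (t : ℕ) :
    Measurable fun p : State N 𝓧 × (Fin N → Draw K 𝓧) => S.communicate t p.1 p.2 := by
  simp only [communicate_eq_swapAll]
  exact S.measurable_swapAll _

theorem fullKernel_map_communicate (d₀ : Draw K 𝓧) (t : ℕ) :
    (S.fullKernel d₀ t).map (fun p => S.communicate t p.1 p.2) = S.stateKernel t := by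
  have hm := S.measurable_communicate t
  ext x C hC
  rw [Kernel.map_apply' _ hm _ hC, fullKernel, Kernel.compProd_apply (hm hC), stateKernel,
    Kernel.comp_apply' _ _ _ hC]
  refine lintegral_congr fun y => ?_
  have hy : Measurable fun d : Fin N → Draw K 𝓧 => S.swapAll (propList N t) d y :=
    (S.measurable_swapAll _).comp measurable_prodMk_left
  rw [← S.listDraw_map_swapAll d₀ (pairwise_apart_propList N t), Measure.map_apply hy hC, Kernel.prodMkLeft_apply]
  congr 1
  ext d
  simp [communicate_eq_swapAll]

/-- Extension of the draws for the proposed swaps by a constant. -/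
def extendDraw (d₀ : Draw K 𝓧) (t : ℕ) (d : {j : Fin N // Proposed t j} → Draw K 𝓧) (j : Fin N) :
    Draw K 𝓧 :=
  if h : Proposed t j then d ⟨j, h⟩ else d₀

theorem measurable_extendDraw (d₀ : Draw K 𝓧) (t : ℕ) :
    Measurable (extendDraw (N := N) d₀ t) := by
  refine measurable_pi_lambda _ fun j => ?_
  unfold extendDraw
  split_ifs
  · exact measurable_pi_apply _
  · exact measurable_const

theorem pi_map_extendDraw (d₀ : Draw K 𝓧) (t : ℕ) (m : Fin N → Measure (Draw K 𝓧))
    [∀ j, IsProbabilityMeasure (m j)] :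
    (Measure.pi fun j : {j : Fin N // Proposed t j} => m j).map (extendDraw d₀ t) =
      Measure.pi fun j => if Proposed t j then m j else Measure.dirac d₀ := by
  have : ∀ j, IsProbabilityMeasure (if Proposed t j then m j else Measure.dirac d₀) := fun j => by
    split_ifs <;> infer_instance
  symm
  refine Measure.pi_eq fun s hs => ?_
  rw [Measure.map_apply (measurable_extendDraw d₀ t) (MeasurableSet.univ_pi hs),
    ← Fintype.prod_subtype_mul_prod_subtype (Proposed t)]
  have h1 : ∏ j : {j : Fin N // Proposed t j},
      (if Proposed t j.1 then m j else Measure.dirac d₀) (s j) = ∏ j : {j // Proposed t j}, m j (s j) :=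
    Finset.prod_congr rfl fun j _ => by rw [if_pos j.2]
  have h2 : ∏ j : {j : Fin N // ¬ Proposed t j},
      (if Proposed t j.1 then m j else Measure.dirac d₀) (s j) =
        ∏ j : {j : Fin N // ¬ Proposed t j}, (s j).indicator 1 d₀ :=
    Finset.prod_congr rfl fun j _ => by rw [if_neg j.2, Measure.dirac_apply' _ (hs _)]
  rw [h1, h2]
  by_cases hd : ∀ j : {j : Fin N // ¬ Proposed t j}, d₀ ∈ s j
  · have h3 : extendDraw d₀ t ⁻¹' Set.univ.pi s =
        Set.univ.pi fun j : {j : Fin N // Proposed t j} => s j := by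
      ext d
      simp only [Set.mem_preimage, Set.mem_univ_pi]
      constructor
      · intro h j
        simpa [extendDraw, j.2] using h j
      · intro h j
        unfold extendDraw
        split_ifs with hj
        · exact h ⟨j, hj⟩
        · exact hd ⟨j, hj⟩
    have h4 : ∏ j : {j : Fin N // ¬ Proposed t j}, (s j).indicator (1 : Draw K 𝓧 → ℝ≥0∞) d₀ = 1 :=
      Finset.prod_eq_one fun j _ => by rw [Set.indicator_of_mem (hd j), Pi.one_apply]
    rw [h3, Measure.pi_pi, h4, mul_one]
  · push Not at hd
    obtain ⟨j, hj⟩ := hd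
    have h3 : extendDraw d₀ t ⁻¹' Set.univ.pi s = ∅ := by
      ext d
      simp only [Set.mem_preimage, Set.mem_univ_pi, Set.mem_empty_iff_false, iff_false]
      intro h
      refine hj ?_
      simpa [extendDraw, j.2] using h j
    rw [h3, measure_empty, Finset.prod_eq_zero (Finset.mem_univ j)
      (Set.indicator_of_notMem hj _), mul_zero]

/-- Draws for swaps that are not proposed are unconstrained in a run. Overwriting them by `d₀` gives
them a law, and gives all draws a type that does not depend on `t`. -/
theorem iterKernel_map_extendDraw (d₀ : Draw K 𝓧) (t : ℕ) :
    (S.iterKernel t).map (fun p => (p.1, extendDraw d₀ t p.2)) = S.fullKernel d₀ t := by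
  have hm : Measurable fun p : State N 𝓧 × ({j : Fin N // Proposed t j} → Draw K 𝓧) =>
      (p.1, extendDraw d₀ t p.2) :=
    measurable_fst.prodMk ((measurable_extendDraw d₀ t).comp measurable_snd)
  ext x C hC
  rw [Kernel.map_apply' _ hm _ hC, iterKernel, fullKernel, Kernel.compProd_apply (hm hC),
    Kernel.compProd_apply hC]
  refine lintegral_congr fun y => ?_
  have h : S.listDraw d₀ (propList N t) y =
      (Measure.pi fun j : {j : Fin N // Proposed t j} => S.drawKernel j y).map
        (extendDraw d₀ t) := by
    rw [pi_map_extendDraw d₀ t (fun j => S.drawKernel j y), listDraw_apply]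
    congr 1
    ext1 j
    simp only [drawOr, mem_propList]
    split_ifs <;> rfl
  rw [Kernel.prodMkLeft_apply, Kernel.prodMkLeft_apply, h, Measure.map_apply
    (measurable_extendDraw d₀ t) (measurable_prodMk_left hC)]
  rfl

theorem fullKernel_bodd (d₀ : Draw K 𝓧) (t : ℕ) :
    S.fullKernel d₀ t.bodd.toNat = S.fullKernel d₀ t := by
  rw [fullKernel, fullKernel, propList_bodd]

theorem stateKernel_bodd (t : ℕ) : S.stateKernel t.bodd.toNat = S.stateKernel t := by
  rw [stateKernel, stateKernel, propList_bodd]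

theorem communicate_bodd (t : ℕ) (y : State N 𝓧) (d : Fin N → Draw K 𝓧) :
    S.communicate t.bodd.toNat y d = S.communicate t y d := by
  rw [communicate_eq_swapAll, communicate_eq_swapAll, propList_bodd]

end Data

end AccelPT

/-! ### Invariance of the joint law, and mixing through draws from the reference. -/

namespace AccelPT

open scoped ENNReal

/-- The factors are replaced one at a time; each step is absolute continuity of a product of two
measures. -/
theorem pi_ac_pi {ι β : Type*} [Fintype ι] [MeasurableSpace β] {μ ν : ι → Measure β}
    [∀ i, IsProbabilityMeasure (μ i)] [∀ i, IsProbabilityMeasure (ν i)] (h : ∀ i, μ i ≪ ν i) :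
    Measure.pi μ ≪ Measure.pi ν := by
  classical
  have hpw : ∀ (s : Finset ι) i, IsProbabilityMeasure (s.piecewise ν μ i) := fun s i => by
    by_cases hi : i ∈ s
    · rw [Finset.piecewise_eq_of_mem _ _ _ hi]; infer_instance
    · rw [Finset.piecewise_eq_of_notMem _ _ _ hi]; infer_instance
  have key : ∀ s : Finset ι, Measure.pi μ ≪ Measure.pi (s.piecewise ν μ) := by
    intro s
    induction s using Finset.induction_on with
    | empty => rw [Finset.piecewise_empty]
    | insert j s hj ih =>
      refine ih.trans ?_
      have := hpw s
      have := hpw (insert j s)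
      have := isProbabilityMeasure_update (μ := s.piecewise ν μ) j (μ j)
      rw [pi_eq_map_update (s.piecewise ν μ) j (μ j),
        pi_eq_map_update ((insert j s).piecewise ν μ) j (μ j), Finset.piecewise_insert,
        Function.update_idem, Function.update_self, Finset.piecewise_eq_of_notMem _ _ _ hj]
      exact ((h j).prod Measure.AbsolutelyContinuous.rfl).map (measurable_update_uncurry j)
  simpa using key Finset.univ

/-- Bounded harmonic functions of a kernel all of whose transition probabilities dominate an
invariant measure are constant. -/
theorem ae_const_of_harmonic {E : Type*} [MeasurableSpace E] {κ : Kernel E E} [IsMarkovKernel κ]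
    {Γ : Measure E} [IsProbabilityMeasure Γ] (hinv : κ.Invariant Γ) (hac : ∀ x, Γ ≪ κ x)
    {h : E → ℝ≥0∞} (hm : Measurable h) (h1 : ∀ x, h x ≤ 1) (hh : ∀ x, ∫⁻ y, h y ∂κ x = h x) :
    ∃ c, h =ᵐ[Γ] fun _ => c := by
  set g : E → ℝ := fun x => (h x).toReal with hg
  have hgm : Measurable g := hm.ennreal_toReal
  have hg0 : ∀ x, 0 ≤ g x := fun x => ENNReal.toReal_nonneg
  have hg1 : ∀ x, g x ≤ 1 := fun x => ENNReal.toReal_le_of_le_ofReal zero_le_one (by simpa using h1 x)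
  have hgh : ∀ x, ∫ y, g y ∂κ x = g x := fun x => by
    rw [hg, integral_toReal hm.aemeasurable
      (Eventually.of_forall fun y => (h1 y).trans_lt ENNReal.one_lt_top), hh]
  have hbdd : ∀ {f : E × E → ℝ}, Measurable f → (∀ p, |f p| ≤ 1) → Integrable f (Γ ⊗ₘ κ) :=
    fun hf hb => Integrable.of_bound hf.aestronglyMeasurable 1 (Eventually.of_forall hb)
  have hmul : ∀ x y, |g x * g y| ≤ 1 := fun x y => by
    rw [abs_of_nonneg (mul_nonneg (hg0 x) (hg0 y))]
    exact mul_le_one₀ (hg1 x) (hg0 y) (hg1 y)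
  have i1 : Integrable (fun p : E × E => g p.1 * g p.1) (Γ ⊗ₘ κ) :=
    hbdd (by fun_prop) fun p => hmul _ _
  have i2 : Integrable (fun p : E × E => g p.2 * g p.2) (Γ ⊗ₘ κ) :=
    hbdd (by fun_prop) fun p => hmul _ _
  have i3 : Integrable (fun p : E × E => g p.1 * g p.2) (Γ ⊗ₘ κ) :=
    hbdd (by fun_prop) fun p => hmul _ _
  have e1 : ∫ p, g p.1 * g p.1 ∂(Γ ⊗ₘ κ) = ∫ x, g x * g x ∂Γ := by
    rw [Measure.integral_compProd i1]
    simp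
  have e3 : ∫ p, g p.1 * g p.2 ∂(Γ ⊗ₘ κ) = ∫ x, g x * g x ∂Γ := by
    rw [Measure.integral_compProd i3]
    refine integral_congr_ae (Eventually.of_forall fun x => ?_)
    simp only
    rw [integral_const_mul, hgh]
  have e2 : ∫ p, g p.2 * g p.2 ∂(Γ ⊗ₘ κ) = ∫ x, g x * g x ∂Γ := by
    conv_rhs => rw [← hinv.def, ← Measure.snd_compProd]
    rw [Measure.snd, integral_map measurable_snd.aemeasurable (by fun_prop)]
  -- The classical `L²` argument: by harmonicity the cross term equals `∫ g²`, and by invariance so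
  -- do both squares.
  have hzero : ∫ p, (g p.1 - g p.2) ^ 2 ∂(Γ ⊗ₘ κ) = 0 := by
    have : ∀ p : E × E, (g p.1 - g p.2) ^ 2 =
        g p.1 * g p.1 + g p.2 * g p.2 - 2 * (g p.1 * g p.2) := fun p => by ring
    simp only [this]
    have i12 : Integrable (fun p : E × E => g p.1 * g p.1 + g p.2 * g p.2) (Γ ⊗ₘ κ) := i1.add i2
    rw [integral_sub i12 (i3.const_mul 2), integral_add i1 i2, integral_const_mul, e1, e2,
      e3]
    ring
  have hsq : Integrable (fun p : E × E => (g p.1 - g p.2) ^ 2) (Γ ⊗ₘ κ) := by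
    refine ((i1.add i2).sub (i3.const_mul 2)).congr (Eventually.of_forall fun p => ?_)
    simp only [Pi.sub_apply, Pi.add_apply]
    ring
  rw [integral_eq_zero_iff_of_nonneg (fun p => sq_nonneg _) hsq] at hzero
  -- A single good `x` suffices: `g` is constant `κ x`-almost everywhere, and `κ x` dominates `Γ`.
  obtain ⟨x, hx⟩ := (Measure.ae_ae_of_ae_compProd hzero).exists
  refine ⟨h x, (hac x).ae_le ?_⟩
  filter_upwards [hx] with y hy
  have hxy : g x = g y := sub_eq_zero.1 (pow_eq_zero_iff two_ne_zero |>.1 hy)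
  exact ((ENNReal.toReal_eq_toReal_iff' ((h1 x).trans_lt ENNReal.one_lt_top).ne
    ((h1 y).trans_lt ENNReal.one_lt_top).ne).1 hxy).symm

namespace Data

variable {𝓧 : Type*} [MeasurableSpace 𝓧] {N K : ℕ} {S : Data N K 𝓧}

theorem Valid.isProbabilityMeasure_jointπ (hS : S.Valid) : IsProbabilityMeasure S.jointπ := by
  have := hS.isProbabilityMeasure_π
  unfold jointπ; infer_instance

theorem Valid.invariant_exploreKernel (hS : S.Valid) : S.exploreKernel.Invariant S.jointπ := by
  have := hS.isProbabilityMeasure_π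
  rw [Kernel.Invariant, jointπ, exploreKernel, pi_bind_prodKernel]
  simp only [(hS.explore_invariant _).def]

theorem Valid.invariant_swapKernel (hS : S.Valid) (j : Fin N) :
    (S.swapKernel j).Invariant S.jointπ := by
  have := hS.isProbabilityMeasure_π
  exact pi_bind_liftPair S.π S.π (castSucc_ne_succ j) _ (fun _ _ _ => rfl)
    (hS.prod_bind_pairKernel j)

theorem Valid.invariant_swapSeq (hS : S.Valid) (l : List (Fin N)) :
    (S.swapSeq l).Invariant S.jointπ := by
  induction l with
  | nil => exact Measure.id_comp
  | cons j l ih => exact ih.comp (hS.invariant_swapKernel j)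

theorem Valid.invariant_stateKernel (hS : S.Valid) (t : ℕ) :
    (S.stateKernel t).Invariant S.jointπ :=
  (hS.invariant_swapSeq _).comp hS.invariant_exploreKernel

/-- `ν` dominates a product measure whose marginals on `F` dominate those of `S.jointπ`. -/
def Fresh (S : Data N K 𝓧) (F : Set (Fin (N + 1))) (ν : Measure (State N 𝓧)) : Prop :=
  ∃ m : Fin (N + 1) → Measure 𝓧, (∀ i, IsProbabilityMeasure (m i)) ∧ (∀ i ∈ F, S.π i ≪ m i) ∧
    Measure.pi m ≪ ν

theorem Fresh.mono {F F' : Set (Fin (N + 1))} {ν : Measure (State N 𝓧)} (h : S.Fresh F ν)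
    (hF : F' ⊆ F) : S.Fresh F' ν := by
  obtain ⟨m, h1, h2, h3⟩ := h
  exact ⟨m, h1, fun i hi => h2 i (hF hi), h3⟩

theorem fresh_dirac (S : Data N K 𝓧) (x : State N 𝓧) : S.Fresh ∅ (Measure.dirac x) := by
  refine ⟨fun i => Measure.dirac (x i), fun i => inferInstance, by simp, ?_⟩
  rw [Measure.pi_eq (μ' := Measure.dirac x) fun s hs => ?_]
  rw [Measure.dirac_apply' _ (MeasurableSet.univ_pi hs)]
  simp only [Measure.dirac_apply' _ (hs _)]
  by_cases h : ∀ i, x i ∈ s i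
  · rw [Set.indicator_of_mem (by simpa using h), Finset.prod_eq_one fun i _ => by simp [h i]]
    rfl
  · obtain ⟨i, hi⟩ := not_forall.1 h
    rw [Set.indicator_of_notMem (by simpa using h), Finset.prod_eq_zero (Finset.mem_univ i)]
    simp [hi]

/-- Invariance preserves domination at the chains in `F`, while chain `0` is redrawn from `π⁰`
whatever its law was. -/
theorem Fresh.explore (hS : S.Valid) {F : Set (Fin (N + 1))} {ν : Measure (State N 𝓧)}
    (h : S.Fresh F ν) : S.Fresh (insert 0 F) (ν.bind S.exploreKernel) := by
  obtain ⟨m, h1, h2, h3⟩ := h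
  refine ⟨fun i => (m i).bind (S.explore i), fun i => inferInstance, fun i hi => ?_, ?_⟩
  · rcases hi with rfl | hi
    · dsimp only
      rw [hS.explore_zero, Measure.const_comp, measure_univ, one_smul]
    · conv_lhs => rw [← (hS.explore_invariant i).def]
      exact (h2 i hi).comp_right _
  · rw [← pi_bind_prodKernel]
    exact h3.comp_right _

/-- The true swap dominates the forced one, which keeps products. If the lower marginal dominates
its `π`, the forward path law from it dominates `ℙ`, hence `ℚ`, hence its end point dominates the
upper `π`; the backward path acts likewise. Freshness is thus exchanged between the two chains. -/
theorem Fresh.swap (hS : S.Valid) {F : Set (Fin (N + 1))} {ν : Measure (State N 𝓧)}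
    (h : S.Fresh F ν) (j : Fin N) :
    S.Fresh {i | Equiv.swap j.castSucc j.succ i ∈ F} (ν.bind (S.swapKernel j)) := by
  obtain ⟨m, h1, h2, h3⟩ := h
  have hne := castSucc_ne_succ j
  set b := ((m j.succ).bind (revPathKernel K (S.bwd j))).map fun p => p 0 with hb
  set f := ((m j.castSucc).bind (pathKernel K (S.fwd j))).map fun p => p (Fin.last K) with hf
  have hbp : IsProbabilityMeasure b :=
    Measure.isProbabilityMeasure_map (measurable_pi_apply _).aemeasurable
  have hfp : IsProbabilityMeasure f :=
    Measure.isProbabilityMeasure_map (measurable_pi_apply _).aemeasurable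
  have p1 := isProbabilityMeasure_update (μ := m) j.castSucc b
  have p2 := isProbabilityMeasure_update (μ := Function.update m j.castSucc b) j.succ f
  refine ⟨Function.update (Function.update m j.castSucc b) j.succ f, p2, fun i hi => ?_, ?_⟩
  · rw [Set.mem_ofPred_eq] at hi
    by_cases hs : i = j.succ
    · subst hs
      rw [Equiv.swap_apply_right] at hi
      rw [Function.update_self, ← S.bwdLaw_map_last j]
      refine ((hS.bwd_ac_fwd j).trans ?_).map (measurable_pi_apply _)
      exact (h2 _ hi).comp_right _
    by_cases hc : i = j.castSucc
    · subst hc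
      rw [Equiv.swap_apply_left] at hi
      rw [Function.update_of_ne hs, Function.update_self, ← S.fwdLaw_map_zero j]
      refine ((hS.fwd_ac_bwd j).trans ?_).map (measurable_pi_apply _)
      exact (h2 _ hi).comp_right _
    rw [Equiv.swap_apply_of_ne_of_ne hc hs] at hi
    rw [Function.update_of_ne hs, Function.update_of_ne hc]
    exact h2 i hi
  · have hforced : (Measure.pi m).bind (liftPair j.castSucc j.succ (S.forcedKernel j)) =
        Measure.pi (Function.update (Function.update m j.castSucc b) j.succ f) := by
      refine pi_bind_liftPair _ _ hne _ (fun i hc hs => ?_) ?_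
      · rw [Function.update_of_ne hs, Function.update_of_ne hc]
      · rw [S.prod_bind_forcedKernel, Function.update_self, Function.update_of_ne hne,
          Function.update_self]
    rw [← hforced]
    refine Measure.AbsolutelyContinuous.comp h3 (Eventually.of_forall fun y => ?_)
    rw [swapKernel, liftPair_apply, liftPair_apply]
    exact (S.forcedKernel_ac_pairKernel j _).map
      ((measurable_update_pair j.castSucc j.succ).comp measurable_prodMk_left)

/-- As the pairs are disjoint, each chain receives from one known chain, its partner or itself; the
three conditions ask that the donors for `F'` lie in `F`. -/
theorem Fresh.swapSeq (hS : S.Valid) {l : List (Fin N)} (hl : l.Pairwise Apart)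
    {F F' : Set (Fin (N + 1))} {ν : Measure (State N 𝓧)} (h : S.Fresh F ν)
    (hcs : ∀ j ∈ l, j.castSucc ∈ F' → j.succ ∈ F) (hs : ∀ j ∈ l, j.succ ∈ F' → j.castSucc ∈ F)
    (hne : ∀ i, (∀ j ∈ l, i ≠ j.castSucc ∧ i ≠ j.succ) → i ∈ F' → i ∈ F) :
    S.Fresh F' (ν.bind (S.swapSeq l)) := by
  induction l generalizing F ν with
  | nil =>
    rw [Data.swapSeq, Measure.id_comp]
    exact h.mono fun i hi => hne i (by simp) hi
  | cons k l ih =>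
    rw [List.pairwise_cons] at hl
    rw [Data.swapSeq, ← Measure.comp_assoc]
    refine ih hl.2 (h.swap hS k) (fun j hj hF => ?_) (fun j hj hF => ?_) fun i hi hF => ?_
    · obtain ⟨h1, h2, h3, h4⟩ := hl.1 j hj
      rw [Set.mem_ofPred_eq, Equiv.swap_apply_of_ne_of_ne h2.symm h4.symm]
      exact hcs j (List.mem_cons_of_mem _ hj) hF
    · obtain ⟨h1, h2, h3, h4⟩ := hl.1 j hj
      rw [Set.mem_ofPred_eq, Equiv.swap_apply_of_ne_of_ne h1.symm h3.symm]
      exact hs j (List.mem_cons_of_mem _ hj) hF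
    · rw [Set.mem_ofPred_eq]
      by_cases hk : i = k.castSucc
      · subst hk
        rw [Equiv.swap_apply_left]
        exact hcs k List.mem_cons_self hF
      by_cases hk' : i = k.succ
      · subst hk'
        rw [Equiv.swap_apply_right]
        exact hs k List.mem_cons_self hF
      rw [Equiv.swap_apply_of_ne_of_ne hk hk']
      refine hne i (fun j hj => ?_) hF
      rcases List.mem_cons.1 hj with rfl | hj
      · exact ⟨hk, hk'⟩
      · exact hi j hj

/-- The first `t` iterations, as a kernel on states. -/
noncomputable def iterate (S : Data N K 𝓧) : ℕ → Kernel (State N 𝓧) (State N 𝓧)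
  | 0 => Kernel.id
  | t + 1 => S.stateKernel (t + 1) ∘ₖ iterate S t

instance isMarkovKernel_iterate : (t : ℕ) → IsMarkovKernel (S.iterate t)
  | 0 => by unfold iterate; infer_instance
  | t + 1 => by
    have := isMarkovKernel_iterate t
    unfold iterate; infer_instance

theorem Valid.invariant_iterate (hS : S.Valid) (t : ℕ) : (S.iterate t).Invariant S.jointπ := by
  induction t with
  | zero => exact Measure.id_comp
  | succ t ih => exact (hS.invariant_stateKernel _).comp ih

/-- If all swaps are accepted, draws from the reference move up from chain `0` to chain `N` and
then down again. -/
theorem Valid.fresh_iterate (hS : S.Valid) (x : State N 𝓧) (t : ℕ) :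
    -- A chain of the parity of `t` carries upward traffic, fresh once `i ≤ t`; a chain of the other
    -- parity carries downward traffic, fresh once the round trip has had `2 * N + 1 - i`
    -- iterations. At `t = 0` nothing has been refreshed yet.
    S.Fresh {i | t ≠ 0 ∧ (((i : ℕ) % 2 = t % 2 ∧ (i : ℕ) ≤ t) ∨
      ((i : ℕ) % 2 ≠ t % 2 ∧ 2 * N + 1 ≤ t + i))} (S.iterate t x) := by
  induction t with
  | zero =>
    rw [iterate, Kernel.id_apply]
    exact (S.fresh_dirac x).mono fun i hi => absurd rfl hi.1
  | succ t ih =>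
    rw [iterate, Kernel.comp_apply, stateKernel, ← Measure.comp_assoc]
    refine (ih.explore hS).swapSeq hS (pairwise_apart_propList N (t + 1)) ?_ ?_ ?_
    · intro j hj
      rw [mem_propList, Proposed, Nat.ModEq] at hj
      simp only [Set.mem_insert_iff, Set.mem_ofPred_eq, Fin.ext_iff, Fin.val_castSucc,
        Fin.val_succ, Fin.val_zero]
      omega
    · intro j hj
      rw [mem_propList, Proposed, Nat.ModEq] at hj
      simp only [Set.mem_insert_iff, Set.mem_ofPred_eq, Fin.ext_iff, Fin.val_castSucc,
        Fin.val_succ, Fin.val_zero]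
      omega
    · intro i hi
      -- Only chains `0` and `N` can be idle. Chain `0` has just been refreshed; at chain `N` upward
      -- traffic turns into downward traffic without moving.
      have h1 : ¬ (0 < (i : ℕ) ∧ (i : ℕ) % 2 = (t + 1) % 2) := by
        rintro ⟨h0, h1⟩
        obtain ⟨j, rfl⟩ := Fin.exists_succ_eq.2 (Fin.pos_iff_ne_zero.1 h0)
        exact (hi j (mem_propList.2 h1)).2 rfl
      have h2 : ¬ ((i : ℕ) < N ∧ ((i : ℕ) + 1) % 2 = (t + 1) % 2) := by
        rintro ⟨h0, h1⟩
        exact (hi ⟨i, h0⟩ (mem_propList.2 h1)).1 rfl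
      have h3 := i.is_lt
      simp only [Set.mem_insert_iff, Set.mem_ofPred_eq, Fin.ext_iff, Fin.val_zero]
      omega

/-- After `2 * (N + 1)` iterations every chain is fresh, in either direction. The number is even, so
the phase of the algorithm is the initial one again. -/
theorem Valid.jointπ_ac_iterate (hS : S.Valid) (x : State N 𝓧) :
    S.jointπ ≪ S.iterate (2 * (N + 1)) x := by
  have := hS.isProbabilityMeasure_π
  obtain ⟨m, h1, h2, h3⟩ := hS.fresh_iterate x (2 * (N + 1))
  refine Measure.AbsolutelyContinuous.trans (pi_ac_pi fun i => h2 i ?_) h3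
  have := i.is_lt
  simp only [Set.mem_ofPred_eq]
  omega

/-- Bounded functions that are harmonic for the alternating iterations are constant. -/
theorem Valid.ae_const_of_harmonic (hS : S.Valid) {h : Bool → State N 𝓧 → ℝ≥0∞}
    (hm : ∀ b, Measurable (h b)) (h1 : ∀ b x, h b x ≤ 1)
    (hh : ∀ b x, ∫⁻ y, h (!b) y ∂S.stateKernel (!b).toNat x = h b x) :
    ∃ c, ∀ b, h b =ᵐ[S.jointπ] fun _ => c := by
  have := hS.isProbabilityMeasure_jointπ
  have hiter : ∀ t x, ∫⁻ y, h t.bodd y ∂S.iterate t x = h false x := by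
    intro t
    induction t with
    | zero =>
      intro x
      rw [iterate, Kernel.id_apply, lintegral_dirac' _ (hm _)]
      rfl
    | succ t ih =>
      intro x
      rw [iterate, Kernel.lintegral_comp _ _ _ (hm _), ← ih x]
      refine lintegral_congr fun y => ?_
      rw [← S.stateKernel_bodd, Nat.bodd_succ, hh]
  obtain ⟨c, hc⟩ := AccelPT.ae_const_of_harmonic (hS.invariant_iterate (2 * (N + 1)))
    hS.jointπ_ac_iterate (hm false) (h1 false) fun x => by
      have := hiter (2 * (N + 1)) x
      simpa using this
  refine ⟨c, fun b => ?_⟩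
  cases b with
  | false => exact hc
  | true =>
    -- The other phase follows in one step: by invariance, the state after an even iteration lies
    -- almost surely where `h false` equals `c`.
    have h2 : ∀ᵐ y ∂S.jointπ.bind (S.stateKernel 0), h false y = c := by
      rw [(hS.invariant_stateKernel 0).def]
      exact hc
    filter_upwards [Measure.ae_ae_of_ae_bind (Kernel.aemeasurable _) h2] with x hx
    rw [← hh true x]
    have : ∫⁻ y, h false y ∂S.stateKernel 0 x = c := by
      rw [lintegral_congr_ae hx]
      simp
    exact this

end Data

end AccelPT

/-! ### The Markov chain of records. -/

namespace AccelPT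

open scoped ENNReal

/-- What happens in one iteration: its parity, the state after local exploration, the draws. -/
abbrev Record (N K : ℕ) (𝓧 : Type*) := Bool × (State N 𝓧 × (Fin N → Draw K 𝓧))

namespace Data

variable {𝓧 : Type*} [MeasurableSpace 𝓧] {N K : ℕ} (S : Data N K 𝓧)

/-- The transition kernel from the record of an iteration to that of the next one. -/
noncomputable def recordKernel (d₀ : Draw K 𝓧) : Kernel (Record N K 𝓧) (Record N K 𝓧) where
  toFun r := (S.fullKernel d₀ (!r.1).toNat (S.communicate r.1.toNat r.2.1 r.2.2)).map
    (Prod.mk (!r.1))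
  measurable' := measurable_from_prod_countable_right fun b => by
    have h : Measurable (Prod.mk (!b) : (State N 𝓧 × (Fin N → Draw K 𝓧)) → Record N K 𝓧) :=
      measurable_prodMk_left
    exact (Measure.measurable_map _ h).comp ((S.fullKernel d₀ (!b).toNat).measurable.comp (S.measurable_communicate b.toNat))

theorem recordKernel_apply (d₀ : Draw K 𝓧) (r : Record N K 𝓧) :
    S.recordKernel d₀ r = (S.fullKernel d₀ (!r.1).toNat
      (S.communicate r.1.toNat r.2.1 r.2.2)).map (Prod.mk (!r.1)) := rfl

instance (d₀ : Draw K 𝓧) : IsMarkovKernel (S.recordKernel d₀) :=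
  ⟨fun _ => Measure.isProbabilityMeasure_map measurable_prodMk_left.aemeasurable⟩

theorem lintegral_recordKernel (d₀ : Draw K 𝓧) (r : Record N K 𝓧) {g : Record N K 𝓧 → ℝ≥0∞}
    (hg : Measurable g) :
    ∫⁻ r', g r' ∂S.recordKernel d₀ r = ∫⁻ p, g (!r.1, p) ∂S.fullKernel d₀ (!r.1).toNat
      (S.communicate r.1.toNat r.2.1 r.2.2) := by
  rw [recordKernel_apply, lintegral_map hg measurable_prodMk_left]

theorem lintegral_communicate (d₀ : Draw K 𝓧) (t : ℕ) (x : State N 𝓧) {g : State N 𝓧 → ℝ≥0∞}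
    (hg : Measurable g) :
    ∫⁻ p, g (S.communicate t p.1 p.2) ∂S.fullKernel d₀ t x = ∫⁻ y, g y ∂S.stateKernel t x := by
  rw [← S.fullKernel_map_communicate d₀ t, Kernel.lintegral_map _ (S.measurable_communicate t) _ hg]

/-- The stationary law of the record of an iteration of parity `b`. -/
noncomputable def phaseLaw (d₀ : Draw K 𝓧) (b : Bool) : Measure (Record N K 𝓧) :=
  (S.jointπ.bind (S.fullKernel d₀ b.toNat)).map (Prod.mk b)

/-- The stationary law of the chain of records. -/
noncomputable def recordLaw (d₀ : Draw K 𝓧) : Measure (Record N K 𝓧) :=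
  (2⁻¹ : ℝ≥0∞) • (S.phaseLaw d₀ false + S.phaseLaw d₀ true)

theorem recordLaw_eq (d₀ : Draw K 𝓧) (b : Bool) :
    S.recordLaw d₀ = (2⁻¹ : ℝ≥0∞) • (S.phaseLaw d₀ b + S.phaseLaw d₀ (!b)) := by
  cases b
  · rfl
  · rw [recordLaw, add_comm (S.phaseLaw d₀ false)]
    rfl

theorem lintegral_phaseLaw (d₀ : Draw K 𝓧) (b : Bool) {g : Record N K 𝓧 → ℝ≥0∞}
    (hg : Measurable g) :
    ∫⁻ r, g r ∂S.phaseLaw d₀ b = ∫⁻ x, ∫⁻ p, g (b, p) ∂S.fullKernel d₀ b.toNat x ∂S.jointπ := by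
  have hb : Measurable fun p => g (b, p) := hg.comp measurable_prodMk_left
  rw [phaseLaw, lintegral_map hg measurable_prodMk_left,
    Measure.lintegral_bind (Kernel.aemeasurable _) hb.aemeasurable]

theorem ae_recordLaw_iff (d₀ : Draw K 𝓧) {p : Record N K 𝓧 → Prop} :
    (∀ᵐ r ∂S.recordLaw d₀, p r) ↔ ∀ b, ∀ᵐ r ∂S.phaseLaw d₀ b, p r := by
  rw [recordLaw, Measure.ae_ennreal_smul_measure_iff (by simp), ae_add_measure_iff, Bool.forall_bool]

variable {S}

theorem Valid.isProbabilityMeasure_phaseLaw (hS : S.Valid) (d₀ : Draw K 𝓧) (b : Bool) :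
    IsProbabilityMeasure (S.phaseLaw d₀ b) := by
  have := hS.isProbabilityMeasure_jointπ
  exact Measure.isProbabilityMeasure_map measurable_prodMk_left.aemeasurable

theorem Valid.isProbabilityMeasure_recordLaw (hS : S.Valid) (d₀ : Draw K 𝓧) :
    IsProbabilityMeasure (S.recordLaw d₀) := by
  have := hS.isProbabilityMeasure_phaseLaw d₀
  refine ⟨?_⟩
  rw [recordLaw, Measure.smul_apply, Measure.add_apply, measure_univ, measure_univ, smul_eq_mul,
    one_add_one_eq_two]
  exact ENNReal.inv_mul_cancel two_ne_zero ENNReal.ofNat_ne_top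

/-- The next record depends on the present one only through the parity and the state after
communication, and the latter has law `jointπ` again. Thus the two phases alternate and their mean
is invariant. -/
theorem Valid.phaseLaw_bind (hS : S.Valid) (d₀ : Draw K 𝓧) (b : Bool) :
    (S.phaseLaw d₀ b).bind (S.recordKernel d₀) = S.phaseLaw d₀ (!b) := by
  refine Measure.ext_of_lintegral _ fun g hg => ?_
  have hb : Measurable fun p => g (!b, p) := hg.comp measurable_prodMk_left
  have hφ : Measurable fun z => ∫⁻ p, g (!b, p) ∂S.fullKernel d₀ (!b).toNat z :=
    hb.lintegral_kernel
  rw [Measure.lintegral_bind (Kernel.aemeasurable _) hg.aemeasurable,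
    S.lintegral_phaseLaw d₀ b hg.lintegral_kernel, S.lintegral_phaseLaw d₀ (!b) hg]
  simp only [S.lintegral_recordKernel d₀ _ hg]
  simp only [S.lintegral_communicate d₀ b.toNat _ hφ]
  rw [← Measure.lintegral_bind (Kernel.aemeasurable _) hφ.aemeasurable,
    (hS.invariant_stateKernel b.toNat).def]

theorem Valid.invariant_recordKernel (hS : S.Valid) (d₀ : Draw K 𝓧) :
    (S.recordKernel d₀).Invariant (S.recordLaw d₀) := by
  rw [Kernel.Invariant, recordLaw, Measure.comp_smul, Measure.comp_add, hS.phaseLaw_bind,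
    hS.phaseLaw_bind, Bool.not_false, Bool.not_true,
    add_comm (S.phaseLaw d₀ true)]

theorem Valid.map_communicate (hS : S.Valid) (d₀ : Draw K 𝓧) (t : ℕ) :
    (S.jointπ.bind (S.fullKernel d₀ t)).map (fun p => S.communicate t p.1 p.2) = S.jointπ := by
  rw [Measure.map_comp _ _ (S.measurable_communicate t), fullKernel_map_communicate,
    (hS.invariant_stateKernel t).def]

theorem measurable_record_communicate (S : Data N K 𝓧) :
    Measurable fun r : Record N K 𝓧 => S.communicate r.1.toNat r.2.1 r.2.2 :=
  measurable_from_prod_countable_right fun b => S.measurable_communicate b.toNat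

theorem Valid.measurePreserving_communicate (hS : S.Valid) (d₀ : Draw K 𝓧) :
    MeasurePreserving (fun r : Record N K 𝓧 => S.communicate r.1.toNat r.2.1 r.2.2)
      (S.recordLaw d₀) S.jointπ := by
  refine ⟨S.measurable_record_communicate, ?_⟩
  have h : ∀ b, (S.phaseLaw d₀ b).map
      (fun r : Record N K 𝓧 => S.communicate r.1.toNat r.2.1 r.2.2) = S.jointπ := fun b => by
    rw [phaseLaw, Measure.map_map S.measurable_record_communicate measurable_prodMk_left]
    exact hS.map_communicate d₀ b.toNat
  rw [recordLaw, Measure.map_smul, Measure.map_add _ _ S.measurable_record_communicate, h, h,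
    ← two_smul ℝ≥0∞, smul_smul, ENNReal.inv_mul_cancel two_ne_zero ENNReal.ofNat_ne_top, one_smul]

theorem Valid.ae_const_of_record_harmonic (hS : S.Valid) (d₀ : Draw K 𝓧)
    {h : Record N K 𝓧 → ℝ≥0∞} (hm : Measurable h) (h1 : ∀ r, h r ≤ 1)
    (hh : ∀ r, ∫⁻ r', h r' ∂S.recordKernel d₀ r = h r) :
    ∃ c, h =ᵐ[S.recordLaw d₀] fun _ => c := by
  set k : Bool → State N 𝓧 → ℝ≥0∞ := fun b x =>
    ∫⁻ p, h (!b, p) ∂S.fullKernel d₀ (!b).toNat x with hk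
  have hkm : ∀ b, Measurable (k b) := fun b =>
    Measurable.lintegral_kernel (hm.comp measurable_prodMk_left)
  -- A harmonic function of the record factors through the parity and the resulting state, which
  -- reduces the claim to `Valid.ae_const_of_harmonic`.
  have hhk : ∀ r, h r = k r.1 (S.communicate r.1.toNat r.2.1 r.2.2) := fun r => by
    rw [← hh r, S.lintegral_recordKernel d₀ r hm]
  obtain ⟨c, hc⟩ := hS.ae_const_of_harmonic (h := k) hkm
    (fun b x => (lintegral_mono fun p => h1 _).trans (by simp)) fun b x => by
      rw [← S.lintegral_communicate d₀ _ x (hkm _)]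
      exact lintegral_congr fun p => (hhk (!b, p)).symm
  refine ⟨c, (S.ae_recordLaw_iff d₀).2 fun b => ?_⟩
  have h2 := hc b
  rw [← hS.map_communicate d₀ b.toNat] at h2
  have h3 := ae_of_ae_map (S.measurable_communicate b.toNat).aemeasurable h2
  have hset : MeasurableSet {r : Record N K 𝓧 | h r = c} := hm (measurableSet_singleton c)
  rw [phaseLaw, ae_map_iff measurable_prodMk_left.aemeasurable hset]
  filter_upwards [h3] with p hp
  rw [hhk]
  exact hp

/-- The record of iteration `s + 1` of a run. -/
def record {Ω : Type*} (d₀ : Draw K 𝓧) (Y : ℕ → Ω → State N 𝓧) (D : ℕ → Fin N → Ω → Draw K 𝓧)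
    (s : ℕ) (ω : Ω) : Record N K 𝓧 :=
  ((s + 1).bodd, Y (s + 1) ω, extendDraw d₀ (s + 1) fun j => D (s + 1) j.1 ω)

theorem measurable_record {Ω : Type*} {m : MeasurableSpace Ω} (d₀ : Draw K 𝓧)
    {Y : ℕ → Ω → State N 𝓧} {D : ℕ → Fin N → Ω → Draw K 𝓧} {s : ℕ} (hY : Measurable (Y (s + 1)))
    (hD : ∀ j, Proposed (s + 1) j → Measurable (D (s + 1) j)) : Measurable (record d₀ Y D s) := by
  have h : Measurable fun ω => fun j : {j : Fin N // Proposed (s + 1) j} => D (s + 1) j.1 ω :=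
    measurable_pi_lambda _ fun j => hD j.1 j.2
  exact measurable_const.prodMk (hY.prodMk ((measurable_extendDraw d₀ (s + 1)).comp h))

section Run

variable {Ω : Type*} {mΩ : MeasurableSpace Ω} {μ : Measure Ω} {ℱ : Filtration ℕ mΩ}
  {X Y : ℕ → Ω → State N 𝓧} {D : ℕ → Fin N → Ω → Draw K 𝓧}

/-- The filtration started at time `1`. -/
def tailFiltration (ℱ : Filtration ℕ mΩ) : Filtration ℕ mΩ where
  seq s := ℱ (s + 1)
  mono' _ _ h := ℱ.mono (Nat.succ_le_succ h)
  le' s := ℱ.le (s + 1)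

theorem IsRun.ae_eq_communicate (hrun : S.IsRun μ ℱ X Y D) (d₀ : Draw K 𝓧) (s : ℕ) :
    ∀ᵐ ω ∂μ, X (s + 1) ω = S.communicate (record d₀ Y D s ω).1.toNat (record d₀ Y D s ω).2.1
      (record d₀ Y D s ω).2.2 := by
  filter_upwards [hrun.update s] with ω hω
  rw [hω, record, communicate_bodd, communicate_eq_swapAll, communicate_eq_swapAll]
  refine S.swapAll_congr (fun j hj => ?_) _
  simp [extendDraw, mem_propList.1 hj]

theorem IsRun.measurable_record (hrun : S.IsRun μ ℱ X Y D) (d₀ : Draw K 𝓧) (s : ℕ) :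
    Measurable[ℱ (s + 1)] (record d₀ Y D s) :=
  Data.measurable_record (m := ℱ (s + 1)) d₀ (hrun.measurable_Y s) (hrun.measurable_D s)

theorem IsRun.measure_inter_record (hrun : S.IsRun μ ℱ X Y D) (d₀ : Draw K 𝓧) (s : ℕ) {A : Set Ω}
    (hA : MeasurableSet[ℱ s] A) {B : Set (Record N K 𝓧)} (hB : MeasurableSet B) :
    μ (A ∩ record d₀ Y D s ⁻¹' B) =
      ∫⁻ ω in A, ((S.fullKernel d₀ (s + 1) (X s ω)).map (Prod.mk (s + 1).bodd)) B ∂μ := by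
  have hm : Measurable fun p : State N 𝓧 × ({j : Fin N // Proposed (s + 1) j} → Draw K 𝓧) =>
      (p.1, extendDraw d₀ (s + 1) p.2) :=
    measurable_fst.prodMk ((measurable_extendDraw d₀ (s + 1)).comp measurable_snd)
  have hB' : MeasurableSet (Prod.mk (s + 1).bodd ⁻¹' B) := measurable_prodMk_left hB
  have h := hrun.sample s A hA _ (hm hB')
  refine Eq.trans ?_ (h.trans (lintegral_congr fun ω => ?_))
  · rfl
  · rw [← S.iterKernel_map_extendDraw d₀ (s + 1), Measure.map_apply measurable_prodMk_left hB,
      Kernel.map_apply' _ hm _ hB']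

theorem IsRun.isChain_record (hrun : S.IsRun μ ℱ X Y D) (d₀ : Draw K 𝓧) :
    IsChain (S.recordKernel d₀) μ (tailFiltration ℱ) (record d₀ Y D) where
  adapted s := hrun.measurable_record d₀ s
  markov s A hA B hB := by
    rw [hrun.measure_inter_record d₀ (s + 1) hA hB]
    refine lintegral_congr_ae (ae_restrict_of_ae ?_)
    filter_upwards [hrun.ae_eq_communicate d₀ s] with ω hω
    have hb : (s + 1 + 1).bodd = !(record d₀ Y D s ω).1 := Nat.bodd_succ _
    rw [recordKernel_apply, ← hω, ← hb, fullKernel_bodd]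

/-- The first record is that of iteration `1`, so its parity is `true`; its law is dominated by the
corresponding half of the stationary law. -/
theorem IsRun.map_record_zero_ac (hrun : S.IsRun μ ℱ X Y D) (d₀ : Draw K 𝓧) :
    μ.map (record d₀ Y D 0) ≪ S.recordLaw d₀ := by
  have hX : Measurable (X 0) := (hrun.measurable_X 0).mono (ℱ.le 0) le_rfl
  have hR : Measurable (record d₀ Y D 0) := (hrun.measurable_record d₀ 0).mono (ℱ.le 1) le_rfl
  have h : μ.map (record d₀ Y D 0) = ((μ.map (X 0)).bind (S.fullKernel d₀ 1)).map (Prod.mk true) := by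
    ext B hB
    have h1 := hrun.measure_inter_record d₀ 0 MeasurableSet.univ hB
    rw [Set.univ_inter, Measure.restrict_univ] at h1
    rw [Measure.map_apply hR hB, h1, Measure.map_apply measurable_prodMk_left hB,
      Measure.bind_apply (measurable_prodMk_left hB) (Kernel.aemeasurable _),
      lintegral_map (Kernel.measurable_coe _ (measurable_prodMk_left hB)) hX]
    refine lintegral_congr fun ω => ?_
    rw [Measure.map_apply measurable_prodMk_left hB]
    rfl
  rw [h]
  have h2 : ((μ.map (X 0)).bind (S.fullKernel d₀ 1)).map (Prod.mk true) ≪ S.phaseLaw d₀ true :=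
    (hrun.init.comp_right _).map measurable_prodMk_left
  refine h2.trans (Measure.AbsolutelyContinuous.mk fun s _ h0 => ?_)
  rw [recordLaw, Measure.smul_apply, Measure.add_apply, smul_eq_mul] at h0
  simp only [mul_eq_zero, ENNReal.inv_eq_zero, ENNReal.ofNat_ne_top, false_or, add_eq_zero] at h0
  exact h0.2

end Run

end Data

end AccelPT

/-! ### Stationary expectations and the three claims. -/

namespace AccelPT

open scoped ENNReal

theorem proposed_or {N : ℕ} (j : Fin N) :
    ∃ b : Bool, Proposed b.toNat j ∧ ¬ Proposed (!b).toNat j := by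
  unfold Proposed Nat.ModEq
  rcases Nat.mod_two_eq_zero_or_one ((j : ℕ) + 1) with h | h
  · exact ⟨false, by simp [h]⟩
  · exact ⟨true, by simp [h]⟩

theorem proposed_bodd {N : ℕ} (t : ℕ) (j : Fin N) : Proposed t.bodd.toNat j ↔ Proposed t j := by
  rw [← mem_propList, propList_bodd, mem_propList]

theorem sum_Icc_eq_sum_range (g : ℕ → ℝ) (T : ℕ) :
    ∑ t ∈ Finset.Icc 1 T, g t = ∑ s ∈ Finset.range T, g (s + 1) := by
  rw [Finset.range_eq_Ico, Finset.sum_Ico_add' g 0 T 1]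
  rfl

namespace Data

variable {𝓧 : Type*} [MeasurableSpace 𝓧] {N K : ℕ} {S : Data N K 𝓧}

theorem Valid.jointπ_map_pair (hS : S.Valid) (j : Fin N) :
    S.jointπ.map (fun y => (y j.castSucc, y j.succ)) = (S.π j.castSucc).prod (S.π j.succ) := by
  have := hS.isProbabilityMeasure_π
  have p1 := isProbabilityMeasure_update (μ := S.π) j.castSucc (S.π j.succ)
  have p2 := isProbabilityMeasure_update (μ := Function.update S.π j.castSucc (S.π j.succ)) j.succ
    (S.π j.succ)
  refine Measure.ext_of_lintegral _ fun g hg => ?_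
  have hm : Measurable fun y : State N 𝓧 => (y j.castSucc, y j.succ) := by fun_prop
  have hgm : Measurable fun y : State N 𝓧 => g (y j.castSucc, y j.succ) := hg.comp hm
  rw [lintegral_map hg hm, jointπ, lintegral_pi_update_pair S.π (castSucc_ne_succ j) (S.π j.succ)
    hgm]
  simp [castSucc_ne_succ j]

/-- The stationary law of the draw for the swap `j`. -/
theorem Valid.phaseLaw_map_draw (hS : S.Valid) (d₀ : Draw K 𝓧) {b : Bool} {j : Fin N}
    (hj : Proposed b.toNat j) :
    (S.phaseLaw d₀ b).map (fun r => r.2.2 j) = (S.fwdLaw j).prod ((S.bwdLaw j).prod volume) := by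
  have hm2 : Measurable fun r : Record N K 𝓧 => r.2.2 j := by fun_prop
  have hm : Measurable fun p : State N 𝓧 × (Fin N → Draw K 𝓧) => p.2 j := by fun_prop
  have h1 : (S.fullKernel d₀ b.toNat).map (fun p => p.2 j) = S.drawKernel j ∘ₖ S.exploreKernel := by
    have h2 : (S.listDraw d₀ (propList N b.toNat)).map (fun d => d j) = S.drawKernel j := by
      ext1 y
      rw [Kernel.map_apply _ (measurable_pi_apply j), listDraw_apply]
      refine (measurePreserving_eval (fun j => S.drawOr d₀ (propList N b.toNat) j y) j).map_eq.trans ?_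
      simp [drawOr, mem_propList, hj]
    rw [← h2, ← Kernel.map_comp, ← Kernel.snd_compProd_prodMkLeft S.exploreKernel, Kernel.snd_eq,
      ← Kernel.map_comp_right _ measurable_snd (measurable_pi_apply j)]
    rfl
  have h3 : S.drawKernel j =
      (S.pairDraw j).comap (fun y : State N 𝓧 => (y j.castSucc, y j.succ)) (by fun_prop) := by
    ext1 y
    rw [drawKernel_apply, Kernel.comap_apply]
  rw [phaseLaw, Measure.map_map hm2 measurable_prodMk_left]
  have h4 : S.jointπ.bind (S.drawKernel j) = (S.fwdLaw j).prod ((S.bwdLaw j).prod volume) := by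
    rw [← hS.prod_bind_pairDraw, ← hS.jointπ_map_pair]
    refine Measure.ext_of_lintegral _ fun g hg => ?_
    rw [Measure.lintegral_bind (Kernel.aemeasurable _) hg.aemeasurable,
      Measure.lintegral_bind (Kernel.aemeasurable _) hg.aemeasurable,
      lintegral_map hg.lintegral_kernel (by fun_prop)]
    simp only [drawKernel_apply]
  have h5 := Measure.map_comp S.jointπ (S.fullKernel d₀ b.toNat) hm
  rw [h1, ← Measure.comp_assoc, hS.invariant_exploreKernel.def, h4] at h5
  exact h5

/-- A function of the draw for the swap `j`, set to zero if the swap is not proposed. -/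
noncomputable def drawValue (j : Fin N) (G : Draw K 𝓧 → ℝ) (r : Record N K 𝓧) : ℝ :=
  if Proposed r.1.toNat j then G (r.2.2 j) else 0

/-- The swap is proposed in exactly one of the two phases, each of weight `1/2`; the factor `2` in
the estimators compensates this. -/
theorem Valid.integral_drawValue (hS : S.Valid) (d₀ : Draw K 𝓧) (j : Fin N) {G : Draw K 𝓧 → ℝ}
    (hG : Integrable G ((S.fwdLaw j).prod ((S.bwdLaw j).prod volume))) :
    Integrable (drawValue j G) (S.recordLaw d₀) ∧ ∫ r, drawValue j G r ∂S.recordLaw d₀ =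
      2⁻¹ * ∫ d, G d ∂(S.fwdLaw j).prod ((S.bwdLaw j).prod volume) := by
  obtain ⟨b, hb, hb'⟩ := proposed_or j
  have hm : Measurable fun r : Record N K 𝓧 => r.2.2 j := by fun_prop
  have hmp : MeasurePreserving (fun r : Record N K 𝓧 => r.2.2 j) (S.phaseLaw d₀ b)
      ((S.fwdLaw j).prod ((S.bwdLaw j).prod volume)) := ⟨hm, hS.phaseLaw_map_draw d₀ hb⟩
  have hphase : ∀ c : Bool, ∀ᵐ r ∂S.phaseLaw d₀ c, r.1 = c := fun c => by
    have hset : MeasurableSet {r : Record N K 𝓧 | r.1 = c} :=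
      measurable_fst (measurableSet_singleton c)
    rw [phaseLaw, ae_map_iff measurable_prodMk_left.aemeasurable hset]
    exact Eventually.of_forall fun _ => rfl
  have e1 : drawValue j G =ᵐ[S.phaseLaw d₀ b] fun r => G (r.2.2 j) := by
    filter_upwards [hphase b] with r hr
    rw [drawValue, hr, if_pos hb]
  have e2 : drawValue j G =ᵐ[S.phaseLaw d₀ (!b)] fun _ => (0 : ℝ) := by
    filter_upwards [hphase (!b)] with r hr
    rw [drawValue, hr, if_neg hb']
  have i1 : Integrable (drawValue j G) (S.phaseLaw d₀ b) :=
    (hmp.integrable_comp_of_integrable hG).congr e1.symm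
  have i2 : Integrable (drawValue j G) (S.phaseLaw d₀ (!b)) :=
    (integrable_zero _ _ _).congr e2.symm
  rw [S.recordLaw_eq d₀ b]
  refine ⟨(i1.add_measure i2).smul_measure (by simp), ?_⟩
  rw [integral_smul_measure, integral_add_measure i1 i2, integral_congr_ae e1,
    integral_congr_ae e2, integral_zero, add_zero, ← hmp.map_eq, integral_map hm.aemeasurable]
  · simp
  · rw [hmp.map_eq]
    exact hG.aestronglyMeasurable

/-- Jarzynski's identity: `exp (-W)` is `exp (-ΔF_n)` times the density `dℚ/dℙ`, which integrates to
`1`. -/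
theorem Valid.integral_exp_neg_work (hS : S.Valid) (j : Fin N) :
    Integrable (fun x => Real.exp (-S.work j x)) (S.fwdLaw j) ∧
      ∫ x, Real.exp (-S.work j x) ∂S.fwdLaw j = Real.exp (-S.ΔFstep j) := by
  have := hS.isProbabilityMeasure_fwdLaw j
  have := hS.isProbabilityMeasure_bwdLaw j
  have h : (fun x => Real.exp (-S.work j x)) =ᵐ[S.fwdLaw j] fun x =>
      Real.exp (-S.ΔFstep j) * ((S.bwdLaw j).rnDeriv (S.fwdLaw j) x).toReal := by
    filter_upwards [hS.ae_rnDeriv_pos_lt_top j] with x hx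
    rw [work, neg_sub', sub_neg_eq_add, Real.exp_add, Real.exp_log
      (ENNReal.toReal_pos hx.1.ne' hx.2.ne)]
  refine ⟨(Measure.integrable_toReal_rnDeriv.const_mul _).congr h.symm, ?_⟩
  rw [integral_congr_ae h, integral_const_mul, Measure.integral_toReal_rnDeriv (hS.bwd_ac_fwd j)]
  simp

/-- Under `ℚ` the inverse of `dℚ/dℙ` is `dℙ/dℚ`, by mutual absolute continuity. -/
theorem Valid.integral_exp_work (hS : S.Valid) (j : Fin N) :
    Integrable (fun x => Real.exp (S.work j x)) (S.bwdLaw j) ∧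
      ∫ x, Real.exp (S.work j x) ∂S.bwdLaw j = Real.exp (S.ΔFstep j) := by
  have := hS.isProbabilityMeasure_fwdLaw j
  have := hS.isProbabilityMeasure_bwdLaw j
  have h : (fun x => Real.exp (S.work j x)) =ᵐ[S.bwdLaw j] fun x =>
      Real.exp (S.ΔFstep j) * ((S.fwdLaw j).rnDeriv (S.bwdLaw j) x).toReal := by
    filter_upwards [(hS.bwd_ac_fwd j).ae_le (hS.ae_rnDeriv_pos_lt_top j),
      Measure.inv_rnDeriv (hS.bwd_ac_fwd j)] with x hx hx'
    rw [work, Real.exp_sub, Real.exp_log (ENNReal.toReal_pos hx.1.ne' hx.2.ne), ← hx',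
      Pi.inv_apply, ENNReal.toReal_inv, div_eq_mul_inv]
  refine ⟨(Measure.integrable_toReal_rnDeriv.const_mul _).congr h.symm, ?_⟩
  rw [integral_congr_ae h, integral_const_mul, Measure.integral_toReal_rnDeriv (hS.fwd_ac_bwd j)]
  simp

theorem sum_ΔFstep (S : Data N K 𝓧) : ∑ j, S.ΔFstep j = S.ΔF := by
  have h : ∀ (n : ℕ) (g : Fin (n + 1) → ℝ), ∑ j : Fin n, (g j.castSucc - g j.succ) =
      g 0 - g (Fin.last n) := by
    intro n
    induction n with
    | zero => intro g; simp
    | succ n ih =>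
      intro g
      rw [Fin.sum_univ_castSucc, Fin.succ_last]
      have := ih fun i => g i.castSucc
      simp only [Fin.succ_castSucc] at this ⊢
      rw [this]
      simp
  exact h N fun n => Real.log (S.Z n)

section Run

variable {Ω : Type*} {mΩ : MeasurableSpace Ω} {μ : Measure Ω}
  {ℱ : Filtration ℕ mΩ} {X Y : ℕ → Ω → State N 𝓧} {D : ℕ → Fin N → Ω → Draw K 𝓧}

theorem IsRun.exists_draw (hS : S.Valid) : Nonempty (Draw K 𝓧) := by
  have := hS.isProbabilityMeasure_π 0
  obtain ⟨x⟩ := (S.π 0).nonempty_of_neZero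
  exact ⟨(fun _ => x, fun _ => x, 0)⟩

theorem sum_proposed_eq_sum_drawValue {𝓨 : Type*} {Y : ℕ → Ω → State N 𝓨}
    {D : ℕ → Fin N → Ω → Draw K 𝓨} (d₀ : Draw K 𝓨) (j : Fin N) (G : Draw K 𝓨 → ℝ) (T : ℕ) (ω : Ω) :
    ∑ t ∈ Finset.Icc 1 T with Proposed t j, G (D t j ω) =
      ∑ s ∈ Finset.range T, drawValue j G (record d₀ Y D s ω) := by
  rw [Finset.sum_filter, sum_Icc_eq_sum_range]
  refine Finset.sum_congr rfl fun s _ => ?_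
  simp only [drawValue, record, proposed_bodd]
  split_ifs with h
  · simp [extendDraw, h]
  · rfl

/-- Invariance propagates absolute continuity from the first record to every later one, so
stationary null sets are null at each fixed time. -/
theorem IsRun.ae_draw (hS : S.Valid) (hrun : S.IsRun μ ℱ X Y D) {t : ℕ} (ht : 1 ≤ t) {j : Fin N}
    (hj : Proposed t j) {p : Draw K 𝓧 → Prop}
    (hp : ∀ᵐ d ∂(S.fwdLaw j).prod ((S.bwdLaw j).prod volume), p d) : ∀ᵐ ω ∂μ, p (D t j ω) := by
  obtain ⟨d₀⟩ := IsRun.exists_draw hS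
  obtain ⟨s, rfl⟩ := Nat.exists_eq_add_of_le' ht
  have hac := (hrun.isChain_record d₀).map_ac (hS.invariant_recordKernel d₀)
    (hrun.map_record_zero_ac d₀) s
  have hm : Measurable fun r : Record N K 𝓧 => r.2.2 j := by fun_prop
  have h : ∀ᵐ r ∂S.recordLaw d₀, Proposed r.1.toNat j → p (r.2.2 j) := by
    rw [ae_recordLaw_iff]
    intro b
    by_cases hb : Proposed b.toNat j
    · rw [← hS.phaseLaw_map_draw d₀ hb] at hp
      filter_upwards [ae_of_ae_map hm.aemeasurable hp] with r hr _ using hr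
    · have hset : MeasurableSet {r : Record N K 𝓧 | r.1 = b} :=
        measurable_fst (measurableSet_singleton b)
      have : ∀ᵐ r ∂S.phaseLaw d₀ b, r.1 = b := by
        rw [phaseLaw, ae_map_iff measurable_prodMk_left.aemeasurable hset]
        exact Eventually.of_forall fun _ => rfl
      filter_upwards [this] with r hr h'
      exact absurd (hr ▸ h') hb
  have hR : Measurable (record d₀ Y D s) :=
    (hrun.measurable_record d₀ s).mono (ℱ.le _) le_rfl
  filter_upwards [ae_of_ae_map hR.aemeasurable (hac.ae_le h)] with ω hω
  have := hω ((proposed_bodd _ _).2 hj)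
  simpa [record, extendDraw, hj] using this

theorem IsRun.freeEnergy_eq (hS : S.Valid) (hrun : S.IsRun μ ℱ X Y D)
    (heq : ∀ j, S.fwdLaw j = S.bwdLaw j) {T : ℕ}
    (hT : ∀ j : Fin N, ∃ t ∈ Finset.Icc 1 T, Proposed t j) :
    ∀ᵐ ω ∂μ, S.freeEnergy D T ω = S.ΔF := by
  have := hS.isProbabilityMeasure_fwdLaw
  have := hS.isProbabilityMeasure_bwdLaw
  have hw : ∀ j, ∀ᵐ x ∂S.fwdLaw j, S.work j x = S.ΔFstep j := fun j => by
    have h1 := Measure.rnDeriv_self (S.fwdLaw j)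
    filter_upwards [h1] with x hx
    rw [work, ← heq j, hx]
    simp
  have hd : ∀ j, ∀ᵐ d ∂(S.fwdLaw j).prod ((S.bwdLaw j).prod (volume : Measure unitInterval)),
      S.work j d.1 = S.ΔFstep j ∧ S.work j d.2.1 = S.ΔFstep j := fun j => by
    have h1 := Measure.quasiMeasurePreserving_fst (μ := S.fwdLaw j)
      (ν := (S.bwdLaw j).prod (volume : Measure unitInterval)) |>.ae (hw j)
    have hw' := hw j
    rw [heq j] at hw'
    have h2 := Measure.quasiMeasurePreserving_snd (μ := S.fwdLaw j)
      (ν := (S.bwdLaw j).prod (volume : Measure unitInterval)) |>.ae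
        ((Measure.quasiMeasurePreserving_fst (μ := S.bwdLaw j)
          (ν := (volume : Measure unitInterval))).ae hw')
    filter_upwards [h1, h2] with d h1 h2 using ⟨h1, h2⟩
  have hall : ∀ᵐ ω ∂μ, ∀ (j : Fin N) (t : ℕ), 1 ≤ t → Proposed t j →
      S.work j (D t j ω).1 = S.ΔFstep j ∧ S.work j (D t j ω).2.1 = S.ΔFstep j := by
    refine ae_all_iff.2 fun j => ae_all_iff.2 fun t => ?_
    by_cases ht : 1 ≤ t ∧ Proposed t j
    · filter_upwards [hrun.ae_draw hS ht.1 ht.2 (hd j)] with ω hω _ _ using hω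
    · exact Eventually.of_forall fun ω h1 h2 => absurd ⟨h1, h2⟩ ht
  filter_upwards [hall] with ω hω
  -- The same factor `c j`, in general not `1`, appears in both estimators and cancels only in their
  -- mean. It must be nonzero for the logarithm of the product to split, which is where nonempty
  -- sums are needed.
  set c : Fin N → ℝ := fun j => (2 / (T : ℝ)) * ((Finset.Icc 1 T).filter (Proposed · j)).card with hc
  have hcpos : ∀ j, c j ≠ 0 := fun j => by
    obtain ⟨t, ht, htj⟩ := hT j
    have hT0 : (T : ℝ) ≠ 0 := by
      have := Finset.mem_Icc.1 ht
      exact Nat.cast_ne_zero.2 (by omega)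
    have hcard : ((Finset.Icc 1 T).filter (Proposed · j)).card ≠ 0 :=
      Finset.card_ne_zero_of_mem (Finset.mem_filter.2 ⟨ht, htj⟩)
    exact mul_ne_zero (div_ne_zero two_ne_zero hT0) (Nat.cast_ne_zero.2 hcard)
  have key : ∀ (a : Fin N → ℝ), ∑ j, Real.log (c j * Real.exp (a j)) =
      ∑ j, Real.log (c j) + ∑ j, a j := fun a => by
    rw [← Finset.sum_add_distrib]
    refine Finset.sum_congr rfl fun j _ => ?_
    rw [Real.log_mul (hcpos j) (Real.exp_pos _).ne', Real.log_exp]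
  have h1 : S.fwdFreeEnergy D T ω = -(∑ j, Real.log (c j) - S.ΔF) := by
    rw [fwdFreeEnergy, ← sum_ΔFstep, sub_eq_add_neg, ← Finset.sum_neg_distrib, ← key,
      ← Real.log_prod fun j _ => mul_ne_zero (hcpos j) (Real.exp_pos _).ne']
    congr 2
    refine Finset.prod_congr rfl fun j _ => ?_
    rw [Finset.sum_congr rfl fun t ht => ?_, Finset.sum_const, nsmul_eq_mul, ← mul_assoc]
    rw [Finset.mem_filter, Finset.mem_Icc] at ht
    rw [(hω j t ht.1.1 ht.2).1]
  have h2 : S.bwdFreeEnergy D T ω = ∑ j, Real.log (c j) + S.ΔF := by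
    rw [bwdFreeEnergy, ← sum_ΔFstep, ← key,
      ← Real.log_prod fun j _ => mul_ne_zero (hcpos j) (Real.exp_pos _).ne']
    congr 1
    refine Finset.prod_congr rfl fun j _ => ?_
    rw [Finset.sum_congr rfl fun t ht => ?_, Finset.sum_const, nsmul_eq_mul, ← mul_assoc]
    rw [Finset.mem_filter, Finset.mem_Icc] at ht
    rw [(hω j t ht.1.1 ht.2).2]
  rw [freeEnergy, h1, h2]
  ring

variable [IsProbabilityMeasure μ]

theorem IsRun.tendsto_average (hS : S.Valid) (hrun : S.IsRun μ ℱ X Y D) (d₀ : Draw K 𝓧)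
    {f : Record N K 𝓧 → ℝ} (hf : Integrable f (S.recordLaw d₀)) :
    ∀ᵐ ω ∂μ, Tendsto (fun T : ℕ => (1 / (T : ℝ)) * ∑ t ∈ Finset.range T, f (record d₀ Y D t ω))
      atTop (𝓝 (∫ r, f r ∂S.recordLaw d₀)) := by
  have := hS.isProbabilityMeasure_recordLaw d₀
  exact (hrun.isChain_record d₀).tendsto_average (hS.invariant_recordKernel d₀)
    (fun h hm h1 hh => hS.ae_const_of_record_harmonic d₀ hm h1 hh) (hrun.map_record_zero_ac d₀) hf

theorem IsRun.tendsto_chainAverage (hS : S.Valid) (hrun : S.IsRun μ ℱ X Y D) (n : Fin (N + 1))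
    {f : 𝓧 → ℝ} (hf : Integrable f (S.π n)) :
    ∀ᵐ ω ∂μ, Tendsto (fun T => chainAverage X n f T ω) atTop (𝓝 (∫ x, f x ∂S.π n)) := by
  have := hS.isProbabilityMeasure_π
  obtain ⟨d₀⟩ := IsRun.exists_draw hS
  have hmp : MeasurePreserving
      (fun r : Record N K 𝓧 => S.communicate r.1.toNat r.2.1 r.2.2 n) (S.recordLaw d₀) (S.π n) :=
    (measurePreserving_eval S.π n).comp (hS.measurePreserving_communicate d₀)
  have hint : ∫ r, f (S.communicate r.1.toNat r.2.1 r.2.2 n) ∂S.recordLaw d₀ = ∫ x, f x ∂S.π n := by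
    conv_rhs => rw [← hmp.map_eq]
    rw [integral_map hmp.measurable.aemeasurable]
    rw [hmp.map_eq]
    exact hf.aestronglyMeasurable
  filter_upwards [hrun.tendsto_average hS d₀ (hmp.integrable_comp_of_integrable hf),
    ae_all_iff.2 (hrun.ae_eq_communicate d₀)] with ω h1 h2
  rw [← hint]
  refine h1.congr fun T => ?_
  rw [chainAverage, sum_Icc_eq_sum_range]
  simp only [h2, Function.comp_apply]

theorem IsRun.tendsto_drawAverage (hS : S.Valid) (hrun : S.IsRun μ ℱ X Y D) (j : Fin N)
    {G : Draw K 𝓧 → ℝ} (hG : Integrable G ((S.fwdLaw j).prod ((S.bwdLaw j).prod volume))) :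
    ∀ᵐ ω ∂μ, Tendsto (fun T : ℕ => (2 / (T : ℝ)) *
      ∑ t ∈ Finset.Icc 1 T with Proposed t j, G (D t j ω)) atTop
        (𝓝 (∫ d, G d ∂(S.fwdLaw j).prod ((S.bwdLaw j).prod volume))) := by
  obtain ⟨d₀⟩ := IsRun.exists_draw hS
  obtain ⟨h1, h2⟩ := hS.integral_drawValue d₀ j hG
  filter_upwards [hrun.tendsto_average hS d₀ h1] with ω hω
  have := hω.const_mul 2
  rw [h2, mul_inv_cancel_left₀ two_ne_zero] at this
  refine this.congr fun T => ?_
  rw [sum_proposed_eq_sum_drawValue d₀ (Y := Y)]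
  ring

theorem IsRun.tendsto_freeEnergy (hS : S.Valid) (hrun : S.IsRun μ ℱ X Y D) :
    ∀ᵐ ω ∂μ, Tendsto (fun T => S.freeEnergy D T ω) atTop (𝓝 S.ΔF) := by
  have := hS.isProbabilityMeasure_fwdLaw
  have := hS.isProbabilityMeasure_bwdLaw
  have hf : ∀ j, ∀ᵐ ω ∂μ, Tendsto (fun T : ℕ => (2 / (T : ℝ)) *
      ∑ t ∈ Finset.Icc 1 T with Proposed t j, Real.exp (-S.work j (D t j ω).1)) atTop
        (𝓝 (Real.exp (-S.ΔFstep j))) := fun j => by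
    have h := hrun.tendsto_drawAverage hS j (G := fun d => Real.exp (-S.work j d.1))
      ((hS.integral_exp_neg_work j).1.comp_fst _)
    rwa [integral_fun_fst (fun x => Real.exp (-S.work j x)), (hS.integral_exp_neg_work j).2,
      probReal_univ, one_smul] at h
  have hb : ∀ j, ∀ᵐ ω ∂μ, Tendsto (fun T : ℕ => (2 / (T : ℝ)) *
      ∑ t ∈ Finset.Icc 1 T with Proposed t j, Real.exp (S.work j (D t j ω).2.1)) atTop
        (𝓝 (Real.exp (S.ΔFstep j))) := fun j => by
    have h := hrun.tendsto_drawAverage hS j (G := fun d => Real.exp (S.work j d.2.1))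
      (((hS.integral_exp_work j).1.comp_fst _).comp_snd _)
    rwa [integral_fun_snd (fun x : Path K 𝓧 × unitInterval => Real.exp (S.work j x.1)),
      integral_fun_fst (fun x => Real.exp (S.work j x)), (hS.integral_exp_work j).2,
      probReal_univ, probReal_univ, one_smul, one_smul] at h
  -- The limits of the averages are exponentials, hence nonzero, and the logarithm is continuous at
  -- their product.
  filter_upwards [ae_all_iff.2 hf, ae_all_iff.2 hb] with ω h1 h2
  have e1 := ((tendsto_finsetProd Finset.univ fun j _ => h1 j).log
    (Finset.prod_ne_zero_iff.2 fun j _ => (Real.exp_pos _).ne')).neg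
  have e2 := (tendsto_finsetProd Finset.univ fun j _ => h2 j).log
    (Finset.prod_ne_zero_iff.2 fun j _ => (Real.exp_pos _).ne')
  rw [← Real.exp_sum, Real.log_exp, Finset.sum_neg_distrib, neg_neg, sum_ΔFstep] at e1
  rw [← Real.exp_sum, Real.log_exp, sum_ΔFstep] at e2
  have := (e1.add e2).div_const 2
  rw [add_self_div_two] at this
  exact this

end Run

end Data

end AccelPT

theorem mainTheorem4 {N K : ℕ} {𝓧 : Type*} [MeasurableSpace 𝓧]
    (S : AccelPT.Data N K 𝓧) (hS : S.Valid)
    {Ω : Type*} {mΩ : MeasurableSpace Ω} (μ : Measure Ω) [IsProbabilityMeasure μ]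
    (ℱ : Filtration ℕ mΩ) (X Y : ℕ → Ω → AccelPT.State N 𝓧)
    (D : ℕ → Fin N → Ω → AccelPT.Draw K 𝓧) (hrun : S.IsRun μ ℱ X Y D) :
    (∀ (n : Fin (N + 1)) (f : 𝓧 → ℝ), Integrable f (S.π n) →
      ∀ᵐ ω ∂μ, Tendsto (fun T => AccelPT.chainAverage X n f T ω) atTop (𝓝 (∫ x, f x ∂S.π n))) ∧
    (∀ᵐ ω ∂μ, Tendsto (fun T => S.freeEnergy D T ω) atTop (𝓝 S.ΔF)) ∧
    ((∀ j, S.fwdLaw j = S.bwdLaw j) →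
      ∀ T : ℕ, (∀ j : Fin N, ∃ t ∈ Finset.Icc 1 T, AccelPT.Proposed t j) →
        ∀ᵐ ω ∂μ, S.freeEnergy D T ω = S.ΔF) := by
  exact ⟨fun n f hf => AccelPT.Data.IsRun.tendsto_chainAverage hS hrun n hf,
    AccelPT.Data.IsRun.tendsto_freeEnergy hS hrun,
    fun heq T hT => AccelPT.Data.IsRun.freeEnergy_eq hS hrun heq hT⟩
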